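/- Let $N$ be a positive integer divisible by $4$, and let $\mathfrak u$ be a complex vector space of dimension $2N$ with a non-degenerate symmetric bilinear form $\langle\cdot,\cdot\rangle$ and an ordered orthonormal basis $\{e_i\}_{i\in\Sigma}$. Let $\mathrm{Cliff}(\mathfrak u)$ be its Clifford algebra (with $v^2=-\langle v,v\rangle$), let $e_I=e_{i_1}\cdots e_{i_k}$ for $I=\{i_1<\dots<i_k\}\subseteq\Sigma$, and let $\mathfrak z=e_\Sigma\in\mathrm{Spin}(\mathfrak u)$. For $x\in\mathrm{Spin}(\mathfrak u)$ let $x(\cdot)\in SO(\mathfrak u)$ be the transformation $v\mapsto xvx^{-1}$; thus $\mathfrak z(\cdot)=-\mathrm{Id}$. Let $E$ be a group of units of $\mathrm{Cliff}(\mathfrak u)$, each of the form $c\,e_I$ with $c\in\mathbb C^\times$, such that $e_\Sigma\in E$, the map $E\to\mathbb F_2^\Sigma$, $c\,e_I\mapsto I$, is injective, and its image is a self-dual code all of whose words have even weight. Let $\mathrm{CM}(\mathfrak u)_E$ be the $\mathrm{Cliff}(\mathfrak u)$-module induced from the trivial $E$-module, and for $x\in \mathrm{Spin}(\mathfrak u)$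 let $\chi_x$ be the trace of $x$ on it. Let $A(\mathfrak u)$ be the module over the Clifford algebra of $\bigoplus_{r\in\mathbb Z+1/2}\mathfrak u\otimes t^r$ (with form $\langle v\otimes t^r,w\otimes t^s\rangle=\langle v,w\rangle\delta_{r+s,0}$) generated by a vector $\mathbf 1$ subject to $v(r)\mathbf 1=0$ for $r>0$, where $v(r)=v\otimes t^r$. Let $A(\mathfrak u)_{\theta,E}$ be the module over the Clifford algebra of $\bigoplus_{r\in\mathbb Z}\mathfrak u\otimes t^r$ generated by a vector $\mathbf 1_E$ subject to $v(r)\mathbf 1_E=0$ for $r>0$ and $g(0)\mathbf 1_E=\mathbf 1_E$ for $g\in E$, where $g\mapsto g(0)$ is the algebra embedding extending $v\mapsto v(0)$. Let a superscript $0$ denote the even part for the parity involution that fixes $\mathbf 1$, respectively $\mathbf 1_E$. Put $$A^f(\mathfrak u)=A(\mathfrak u)^0\oplus A(\mathfrak u)^0_{\theta,E},$$ graded by the eigenvalues of $L(0)$, the coefficient of $z^{-2}$ in the vertex operator $Y(\omega,z)$ of the Virasoro element $\omega=\frac14\sum_i e_i(-\frac12)e_i(-\frac32)\mathbf 1$,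 of rank $c=N$; explicitly, with $e_i(z)=\sum_r e_i(r)z^{-r-1/2}$, $Y(\omega,z)$ is $\frac14\sum_i{:}e_i(z)\,\partial_z e_i(z){:}$ on $A(\mathfrak u)$, and this plus $\frac N8z^{-2}$ on $A(\mathfrak u)_{\theta,E}$. An element $x\in\mathrm{Spin}(\mathfrak u)$ acts on $A(\mathfrak u)$ by $v(r)\mapsto (x(v))(r)$, fixing $\mathbf 1$, and on $A(\mathfrak u)_{\theta,E}$ compatibly with $v(r)\mapsto (x(v))(r)$ and with $\mathbf 1_E\mapsto x(0)\mathbf 1_E$. The element $\mathfrak z$ acts trivially on $A^f(\mathfrak u)$, so $\mathrm{Spin}(\mathfrak u)/\langle\mathfrak z\rangle$ acts on $A^f(\mathfrak u)$. A linear map $h$ of $\mathfrak u$ admits the Frame shape $\prod_{k\mid n}k^{m_k}$ (with $n\ge1$ and $m_k\in\mathbb Z$) if $\det(\mathrm{Id}-hx)=\prod_{k\mid n}(1-x^k)^{m_k}$ as rational functions of $x$; then $\eta_h(\tau)=\prod_{k\mid n}\eta(k\tau)^{m_k}$, with $\eta$ the Dedekind eta function. **Theorem.** Let $g\in\mathrm{Spin}(\mathfrak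 u)/\langle\mathfrak z\rangle$, let $\hat g\in\mathrm{Spin}(\mathfrak u)$ be a lift of $g$ and $\bar g=\hat g(\cdot)\in SO(\mathfrak u)$ its image, and suppose that both $\bar g$ and $-\bar g$ admit Frame shapes. Then $A^f(\mathfrak u)$ is the direct sum of the eigenspaces $A^f(\mathfrak u)_n$ of $L(0)$ with eigenvalues $n\in\mathbb Q$, these are finite-dimensional and preserved by $g$, and for every $\tau$ in the upper half plane, with $q^s=e^{2\pi i\tau s}$, the McKay–Thompson series $\sum_{n}\mathrm{tr}\big(g|_{A^f(\mathfrak u)_n}\big)q^{n-c/24}$ converges absolutely and $$\sum_{n}\mathrm{tr}\big(g|_{A^f(\mathfrak u)_n}\big)q^{n-c/24}=\frac12\left(\frac{\eta_{\bar g}(\tau/2)}{\eta_{\bar g}(\tau)}+\frac{\eta_{-\bar g}(\tau/2)}{\eta_{-\bar g}(\tau)}+\chi_{\mathfrak z\hat g}\,\eta_{\bar g}(\tau)+\chi_{\hat g}\,\eta_{-\bar g}(\tau)\right).$$ -/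

import Mathlib

open CliffordAlgebra

namespace CliffordVOA

noncomputable section

/-- The cyclic left module `C ⧸ J` over a complex algebra `C`, for a left ideal `J`. -/
def CyclicModule {C : Type*} [Ring C] [Algebra ℂ C] (J : Submodule C C) : Type _ :=
  @HasQuotient.Quotient C (Submodule C C) Submodule.hasQuotient J

namespace CyclicModule

variable {C : Type*} [Ring C] [Algebra ℂ C] (J : Submodule C C)

instance : AddCommGroup (CyclicModule J) := Submodule.Quotient.addCommGroup J

instance : Module C (CyclicModule J) := Submodule.Quotient.module J

instance : Module ℂ (CyclicModule J) := Submodule.Quotient.module' J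

instance : IsScalarTower ℂ C (CyclicModule J) where
  smul_assoc c a b := by
    obtain ⟨d, rfl⟩ := Submodule.Quotient.mk_surjective J b
    exact congrArg Submodule.Quotient.mk (smul_assoc c a d)

/-- The quotient map `C → C ⧸ J`. -/
def mk : C →ₗ[C] CyclicModule J := J.mkQ

theorem mk_surjective : Function.Surjective (mk J) := Submodule.Quotient.mk_surjective J

theorem mk_eq_zero {a : C} : mk J a = 0 ↔ a ∈ J := Submodule.Quotient.mk_eq_zero J

/-- The linear endomorphism of `C ⧸ J` induced by a linear endomorphism of `C` preserving `J`. -/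
def mapEnd (f : C →ₗ[ℂ] C) (hf : ∀ a ∈ J, f a ∈ J) : Module.End ℂ (CyclicModule J) :=
  @Submodule.mapQ ℂ C _ _ _ (J.restrictScalars ℂ) ℂ C _ _ _ (RingHom.id ℂ)
    (J.restrictScalars ℂ) f hf

theorem mapEnd_mk (f : C →ₗ[ℂ] C) (hf : ∀ a ∈ J, f a ∈ J) (a : C) :
    mapEnd J f hf (mk J a) = mk J (f a) := rfl

end CyclicModule

/-- A complex vector space `𝔲` of dimension `2 * N` with a (necessarily symmetric and
non-degenerate) bilinear form and a chosen ordered orthonormal basis `e_i`, `i ∈ Σ`. -/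
structure OrthoSpace (V : Type*) [AddCommGroup V] [Module ℂ V] (N : ℕ) where
  form : LinearMap.BilinForm ℂ V
  basis : Module.Basis (Fin (2 * N)) ℂ V
  orthonormal : ∀ i j, form (basis i) (basis j) = if i = j then 1 else 0

/-- The sector: half-odd-integral modes (untwisted) or integral modes (twisted). -/
inductive Sector
  | untwisted
  | twisted

/-- Modes in the sector `σ` have degrees `m + σ.shift / 2` with `m ∈ ℤ`. -/
def Sector.shift : Sector → ℤ
  | .untwisted => 1
  | .twisted => 0

namespace OrthoSpace

variable {V : Type*} [AddCommGroup V] [Module ℂ V] {N : ℕ} (u : OrthoSpace V N)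

theorem form_symm (x y : V) : u.form x y = u.form y x := by
  have h : u.form = u.form.flip := by
    refine u.basis.ext fun i => u.basis.ext fun j => ?_
    change u.form (u.basis i) (u.basis j) = u.form (u.basis j) (u.basis i)
    rw [u.orthonormal, u.orthonormal]
    simp only [eq_comm]
  exact congrArg (fun f => f x y) h

/-- The quadratic form `v ↦ -⟨v, v⟩`. -/
def quad : QuadraticForm ℂ V := -u.form.toQuadraticMap

theorem quad_apply (v : V) : u.quad v = -u.form v v := rfl

/-- `Cliff(𝔲)`, in which `v * v = -⟨v, v⟩`. -/
abbrev Cliff : Type _ := CliffordAlgebra u.quad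

/-- `Spin(𝔲)`: the even elements `x` of the Clifford algebra that preserve `𝔲` under conjugation
and satisfy `α(x) x = 1`. -/
abbrev Spin : Type _ := ↥(spinGroup u.quad)

/-! ### The map from the spin group to the orthogonal group -/

theorem ι_injective : Function.Injective (ι u.quad) := by
  have : Invertible (2 : ℂ) := invertibleOfNonzero two_ne_zero
  intro a b h
  have h2 := congrArg (changeForm (Q := u.quad) (Q' := 0) changeForm.associated_neg_proof) h
  rw [changeForm_ι, changeForm_ι] at h2
  exact ExteriorAlgebra.ι_leftInverse.injective h2

theorem conj_mem (x : u.Spin) (v : V) :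
    (x : u.Cliff) * ι u.quad v * ((x⁻¹ : u.Spin) : u.Cliff) ∈ LinearMap.range (ι u.quad) := by
  have : Invertible (2 : ℂ) := invertibleOfNonzero two_ne_zero
  have h := spinGroup.conjAct_smul_ι_mem_range_ι (x := spinGroup.toUnits x) x.2 v
  rwa [ConjAct.units_smul_def, ConjAct.ofConjAct_toConjAct] at h

/-- The transformation `v ↦ x v x⁻¹` of `𝔲` attached to `x ∈ Spin(𝔲)`. -/
def toSO (x : u.Spin) : V →ₗ[ℂ] V :=
  (LinearEquiv.ofInjective (ι u.quad) u.ι_injective).symm.toLinearMap ∘ₗ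
    LinearMap.codRestrict (LinearMap.range (ι u.quad))
      (LinearMap.mulRight ℂ ((x⁻¹ : u.Spin) : u.Cliff) ∘ₗ LinearMap.mulLeft ℂ (x : u.Cliff) ∘ₗ
        ι u.quad)
      (fun v => u.conj_mem x v)

theorem ι_toSO (x : u.Spin) (v : V) :
    ι u.quad (u.toSO x v) =
      (x : u.Cliff) * ι u.quad v * ((x⁻¹ : u.Spin) : u.Cliff) := by
  have h := LinearEquiv.apply_symm_apply (LinearEquiv.ofInjective (ι u.quad) u.ι_injective)
    ⟨_, u.conj_mem x v⟩
  exact congrArg Subtype.val h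

theorem coe_mul_inv (x : u.Spin) : (x : u.Cliff) * ((x⁻¹ : u.Spin) : u.Cliff) = 1 :=
  spinGroup.coe_mul_star_self x

theorem coe_inv_mul (x : u.Spin) : ((x⁻¹ : u.Spin) : u.Cliff) * (x : u.Cliff) = 1 :=
  spinGroup.coe_star_mul_self x

theorem quad_toSO (x : u.Spin) (v : V) : u.quad (u.toSO x v) = u.quad v := by
  apply (algebraMap ℂ u.Cliff).injective
  rw [← ι_sq_scalar, ι_toSO]
  calc (x : u.Cliff) * ι u.quad v * ((x⁻¹ : u.Spin) : u.Cliff) *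
        ((x : u.Cliff) * ι u.quad v * ((x⁻¹ : u.Spin) : u.Cliff))
      = (x : u.Cliff) * ι u.quad v * (((x⁻¹ : u.Spin) : u.Cliff) * (x : u.Cliff)) * ι u.quad v *
          ((x⁻¹ : u.Spin) : u.Cliff) := by simp only [mul_assoc]
    _ = (x : u.Cliff) * (ι u.quad v * ι u.quad v) * ((x⁻¹ : u.Spin) : u.Cliff) := by
        rw [coe_inv_mul]; simp only [mul_assoc, mul_one]
    _ = algebraMap ℂ u.Cliff (u.quad v) := by
        rw [ι_sq_scalar, ← Algebra.commutes, mul_assoc, coe_mul_inv, mul_one]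

theorem form_toSO (x : u.Spin) (v w : V) : u.form (u.toSO x v) (u.toSO x w) = u.form v w := by
  have h := u.quad_toSO x (v + w)
  have h1 := u.quad_toSO x v
  have h2 := u.quad_toSO x w
  simp only [quad_apply, map_add, LinearMap.add_apply] at h h1 h2
  rw [u.form_symm (u.toSO x w) (u.toSO x v), u.form_symm w v] at h
  linear_combination (-1 / 2) * h + (1 / 2) * h1 + (1 / 2) * h2

theorem toSO_one : u.toSO 1 = LinearMap.id := by
  ext v
  apply u.ι_injective
  rw [ι_toSO]
  simp

theorem toSO_mul (x y : u.Spin) : u.toSO (x * y) = u.toSO x ∘ₗ u.toSO y := by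
  ext v
  apply u.ι_injective
  simp only [LinearMap.comp_apply, ι_toSO, mul_inv_rev, Submonoid.coe_mul, mul_assoc]

/-! ### The infinite-dimensional inner product spaces and their Clifford algebras -/

/-- The bilinear form on `𝔲̂` with `⟨v ⊗ t^r, w ⊗ t^s⟩ = ⟨v, w⟩ δ_{r+s,0}`.  The space is
`ℤ →₀ V`, where `Finsupp.single m v` stands for `v ⊗ t^(m + σ.shift / 2)`. -/
def hatForm (σ : Sector) : LinearMap.BilinForm ℂ (ℤ →₀ V) :=
  Finsupp.lsum ℂ fun m : ℤ =>
    LinearMap.lcomp ℂ ℂ (Finsupp.lapply (-m - σ.shift) : (ℤ →₀ V) →ₗ[ℂ] V) ∘ₗ u.form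

theorem hatForm_single (σ : Sector) (m : ℤ) (v : V) (y : ℤ →₀ V) :
    u.hatForm σ (Finsupp.single m v) y = u.form v (y (-m - σ.shift)) := by
  simp [hatForm]

theorem hatForm_apply (σ : Sector) (x y : ℤ →₀ V) :
    u.hatForm σ x y = x.sum fun m v => u.form v (y (-m - σ.shift)) := by
  simp [hatForm, Finsupp.sum, LinearMap.sum_apply]

theorem hatForm_symm (σ : Sector) (x y : ℤ →₀ V) : u.hatForm σ x y = u.hatForm σ y x := by
  have h : u.hatForm σ = (u.hatForm σ).flip := by
    ext m v n w
    change u.hatForm σ (Finsupp.single m v) (Finsupp.single n w) =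
      u.hatForm σ (Finsupp.single n w) (Finsupp.single m v)
    rw [hatForm_single, hatForm_single, Finsupp.single_apply, Finsupp.single_apply]
    by_cases hmn : n = -m - σ.shift
    · have h2 : m = -n - σ.shift := by omega
      rw [if_pos hmn, if_pos h2, u.form_symm]
    · have h2 : ¬ m = -n - σ.shift := by omega
      rw [if_neg hmn, if_neg h2, map_zero, map_zero]
  exact congrArg (fun f => f x y) h

/-- The quadratic form `x ↦ -⟨x, x⟩` on `𝔲̂`. -/
def hatQuad (σ : Sector) : QuadraticForm ℂ (ℤ →₀ V) := -(u.hatForm σ).toQuadraticMap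

theorem hatQuad_apply (σ : Sector) (x : ℤ →₀ V) : u.hatQuad σ x = -u.hatForm σ x x := rfl

/-- `Cliff(𝔲̂)` for the untwisted sector, `Cliff(𝔲̂_θ)` for the twisted sector. -/
abbrev HatCliff (σ : Sector) : Type _ := CliffordAlgebra (u.hatQuad σ)

/-- The generator `v(r)` of the Clifford algebra, where `r = m + σ.shift / 2`. -/
def mode (σ : Sector) (v : V) (m : ℤ) : u.HatCliff σ := ι (u.hatQuad σ) (Finsupp.single m v)

theorem ι_mul_ι_swap (σ : Sector) (x y : ℤ →₀ V) :
    ι (u.hatQuad σ) x * ι (u.hatQuad σ) y =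
      -(ι (u.hatQuad σ) y * ι (u.hatQuad σ) x) +
        algebraMap ℂ _ (-2 * u.hatForm σ x y) := by
  have h := ι_mul_ι_add_swap (Q := u.hatQuad σ) x y
  have hp : QuadraticMap.polar (u.hatQuad σ) x y = -2 * u.hatForm σ x y := by
    simp only [QuadraticMap.polar, hatQuad_apply, map_add, LinearMap.add_apply]
    rw [u.hatForm_symm σ y x]
    ring
  rw [hp] at h
  rw [← h]
  abel

/-- The embedding `𝔲 → 𝔲̂_θ`, `v ↦ v(0)`. -/
def zeroIsometry : u.quad →qᵢ u.hatQuad .twisted where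
  toLinearMap := Finsupp.lsingle 0
  map_app' v := by
    simp [hatQuad_apply, quad_apply, hatForm_single, Sector.shift]

/-- The embedding `Cliff(𝔲) → Cliff(𝔲̂_θ)` induced by `v ↦ v(0)`. -/
def zeroEmb : u.Cliff →ₐ[ℂ] u.HatCliff .twisted := CliffordAlgebra.map u.zeroIsometry

theorem zeroEmb_ι (v : V) : u.zeroEmb (ι u.quad v) = u.mode .twisted v 0 :=
  CliffordAlgebra.map_apply_ι _ _

/-- The isometry of `𝔲̂` induced by the image of `x` in the orthogonal group. -/
def hatIsometry (σ : Sector) (x : u.Spin) : u.hatQuad σ →qᵢ u.hatQuad σ where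
  toLinearMap := Finsupp.mapRange.linearMap (u.toSO x)
  map_app' y := by
    have h : (u.hatForm σ).compl₁₂ (Finsupp.mapRange.linearMap (u.toSO x))
        (Finsupp.mapRange.linearMap (u.toSO x)) = u.hatForm σ := by
      ext m v n w
      simp only [LinearMap.comp_apply, Finsupp.lsingle_apply, LinearMap.compl₁₂_apply,
        Finsupp.mapRange.linearMap_apply, Finsupp.mapRange_single, hatForm_single,
        Finsupp.single_apply]
      by_cases hmn : n = -m - σ.shift
      · rw [if_pos hmn, if_pos hmn, u.form_toSO]
      · rw [if_neg hmn, if_neg hmn, map_zero, map_zero]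
    exact congrArg (fun f => -f y y) h

/-- The automorphism of `Cliff(𝔲̂)` with `v(r) ↦ (x v x⁻¹)(r)`. -/
def hatAut (σ : Sector) (x : u.Spin) : u.HatCliff σ →ₐ[ℂ] u.HatCliff σ :=
  CliffordAlgebra.map (u.hatIsometry σ x)

theorem hatAut_ι (σ : Sector) (x : u.Spin) (y : ℤ →₀ V) :
    u.hatAut σ x (ι _ y) = ι _ (Finsupp.mapRange.linearMap (u.toSO x) y) :=
  CliffordAlgebra.map_apply_ι _ _

theorem hatAut_mode (σ : Sector) (x : u.Spin) (v : V) (m : ℤ) :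
    u.hatAut σ x (u.mode σ v m) = u.mode σ (u.toSO x v) m := by
  rw [mode, hatAut_ι]
  simp [mode]

theorem hatAut_one (σ : Sector) : u.hatAut σ 1 = AlgHom.id ℂ _ := by
  apply CliffordAlgebra.hom_ext
  ext m v
  change u.hatAut σ 1 (u.mode σ v m) = u.mode σ v m
  rw [hatAut_mode, toSO_one]; rfl

theorem hatAut_mul (σ : Sector) (x y : u.Spin) (a : u.HatCliff σ) :
    u.hatAut σ (x * y) a = u.hatAut σ x (u.hatAut σ y a) := by
  have h : u.hatAut σ (x * y) = (u.hatAut σ x).comp (u.hatAut σ y) := by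
    apply CliffordAlgebra.hom_ext
    ext m v
    change u.hatAut σ (x * y) (u.mode σ v m) = u.hatAut σ x (u.hatAut σ y (u.mode σ v m))
    rw [hatAut_mode, hatAut_mode, hatAut_mode, toSO_mul]; rfl
  exact congrArg (fun f => f a) h

theorem hatAut_zeroEmb (x : u.Spin) (a : u.Cliff) :
    u.hatAut .twisted x (u.zeroEmb a) =
      u.zeroEmb ((x : u.Cliff) * a * ((x⁻¹ : u.Spin) : u.Cliff)) := by
  induction a using CliffordAlgebra.induction with
  | algebraMap r =>
    rw [← Algebra.commutes, mul_assoc, coe_mul_inv, mul_one]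
    simp
  | ι v => rw [zeroEmb_ι, hatAut_mode, ← ι_toSO, zeroEmb_ι]
  | mul a b ha hb =>
    rw [map_mul, map_mul, ha, hb, ← map_mul]
    congr 1
    calc (x : u.Cliff) * a * ((x⁻¹ : u.Spin) : u.Cliff) *
          ((x : u.Cliff) * b * ((x⁻¹ : u.Spin) : u.Cliff))
        = (x : u.Cliff) * a * (((x⁻¹ : u.Spin) : u.Cliff) * (x : u.Cliff)) * b *
            ((x⁻¹ : u.Spin) : u.Cliff) := by simp only [mul_assoc]
      _ = _ := by rw [coe_inv_mul]; simp only [mul_assoc, one_mul]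
  | add a b ha hb => rw [map_add, map_add, ha, hb, ← map_add, mul_add, add_mul]

theorem hatAut_even (σ : Sector) (x : u.Spin) {a : u.HatCliff σ}
    (ha : a ∈ evenOdd (u.hatQuad σ) 0) : u.hatAut σ x a ∈ evenOdd (u.hatQuad σ) 0 := by
  induction a, ha using CliffordAlgebra.even_induction with
  | algebraMap r =>
    rw [AlgHom.commutes]
    exact one_le_evenOdd_zero _ (Submodule.mem_one.2 ⟨r, rfl⟩)
  | add a b _ _ ha hb => rw [map_add]; exact Submodule.add_mem _ ha hb
  | ι_mul_ι_mul a b c _ hc =>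
    rw [map_mul, map_mul, hatAut_ι, hatAut_ι]
    have h := evenOdd_mul_le (u.hatQuad σ) 0 0
      (Submodule.mul_mem_mul (ι_mul_ι_mem_evenOdd_zero (u.hatQuad σ)
        (Finsupp.mapRange.linearMap (u.toSO x) a) (Finsupp.mapRange.linearMap (u.toSO x) b)) hc)
    simpa using h

theorem zeroEmb_even {a : u.Cliff} (ha : a ∈ evenOdd u.quad 0) :
    u.zeroEmb a ∈ evenOdd (u.hatQuad .twisted) 0 := by
  induction a, ha using CliffordAlgebra.even_induction with
  | algebraMap r =>
    rw [AlgHom.commutes]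
    exact one_le_evenOdd_zero _ (Submodule.mem_one.2 ⟨r, rfl⟩)
  | add a b _ _ ha hb => rw [map_add]; exact Submodule.add_mem _ ha hb
  | ι_mul_ι_mul a b c _ hc =>
    rw [map_mul, map_mul, zeroEmb_ι, zeroEmb_ι]
    have h := evenOdd_mul_le (u.hatQuad .twisted) 0 0
      (Submodule.mul_mem_mul (ι_mul_ι_mem_evenOdd_zero (u.hatQuad .twisted)
        (Finsupp.single 0 a) (Finsupp.single 0 b)) hc)
    simpa [mode] using h

/-- An even element of `Cliff(𝔲)` commutes with `v(m)` for `m ≠ 0`. -/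
theorem zeroEmb_comm {a : u.Cliff} (ha : a ∈ evenOdd u.quad 0) (v : V) {m : ℤ} (hm : m ≠ 0) :
    u.mode .twisted v m * u.zeroEmb a = u.zeroEmb a * u.mode .twisted v m := by
  have hsw : ∀ w : V, u.mode .twisted v m * u.mode .twisted w 0 =
      -(u.mode .twisted w 0 * u.mode .twisted v m) := by
    intro w
    have h := u.ι_mul_ι_swap .twisted (Finsupp.single m v) (Finsupp.single 0 w)
    rw [hatForm_single, Finsupp.single_apply, if_neg (by simp [Sector.shift, hm])] at h
    simpa [mode] using h
  induction a, ha using CliffordAlgebra.even_induction with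
  | algebraMap r => rw [AlgHom.commutes, Algebra.commutes]
  | add a b _ _ ha hb => rw [map_add, mul_add, add_mul, ha, hb]
  | ι_mul_ι_mul a b c _ hc =>
    rw [map_mul, map_mul, zeroEmb_ι, zeroEmb_ι, ← mul_assoc, ← mul_assoc, hsw a, neg_mul,
      mul_assoc (u.mode .twisted a 0), hsw b, mul_neg, neg_neg, mul_assoc, mul_assoc, hc]
    simp only [mul_assoc]

/-! ### Homogeneous lifts of codes -/

/-- The monomial `e_I = e_{i₁} ⋯ e_{i_k}` with `I = {i₁ < ⋯ < i_k}`. -/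
def monomial (I : Finset (Fin (2 * N))) : u.Cliff :=
  ((I.sort (· ≤ ·)).map fun i => ι u.quad (u.basis i)).prod

/-- The binary code of all `I ⊆ Σ` such that `E` meets `ℂ e_I`. -/
def code (E : Subgroup u.Cliffˣ) : Set (Finset (Fin (2 * N))) :=
  {I | ∃ g ∈ E, ∃ c : ℂ, (g : u.Cliff) = c • u.monomial I}

/-- A homogeneous lift `E` of an even self-dual binary code on `Σ`: a group of units of `Cliff(𝔲)`
consisting of homogeneous elements `c e_I`, mapped injectively to the code, and containing the
monomial `e_Σ`. -/
structure HomogeneousLift where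
  group : Subgroup u.Cliffˣ
  homogeneous : ∀ g ∈ group, ∃ (I : Finset (Fin (2 * N))) (c : ℂ), (g : u.Cliff) = c • u.monomial I
  injective : ∀ g ∈ group, ∀ h ∈ group, ∀ (I : Finset (Fin (2 * N))) (c d : ℂ),
    (g : u.Cliff) = c • u.monomial I → (h : u.Cliff) = d • u.monomial I → g = h
  even : ∀ I ∈ u.code group, Even I.card
  selfDual : ∀ I, I ∈ u.code group ↔ ∀ J ∈ u.code group, Even (I ∩ J).card
  top_mem : ∃ g ∈ group, (g : u.Cliff) = u.monomial Finset.univ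

/-! ### The Clifford modules -/

/-- The left ideal generated by the modes of positive degree. -/
def positiveIdeal (σ : Sector) : Submodule (u.HatCliff σ) (u.HatCliff σ) :=
  Submodule.span _ {a | ∃ (v : V) (m : ℤ), 0 < 2 * m + σ.shift ∧ a = u.mode σ v m}

/-- `A(𝔲)`: the `Cliff(𝔲̂)`-module generated by a vacuum vector killed by all `v(r)`, `r > 0`. -/
abbrev A : Type _ := CyclicModule (u.positiveIdeal .untwisted)

variable {u} in
/-- The left ideal generated by the modes of positive degree and by the `g(0) - 1`, `g ∈ E`. -/
def twistedIdeal (E : u.HomogeneousLift) :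
    Submodule (u.HatCliff .twisted) (u.HatCliff .twisted) :=
  u.positiveIdeal .twisted ⊔
    Submodule.span _ {a | ∃ g ∈ E.group, a = u.zeroEmb (g : u.Cliff) - 1}

variable {u} in
/-- `A(𝔲)_{θ,E}`: the `Cliff(𝔲̂_θ)`-module generated by a vector killed by all `v(r)`, `r > 0`, and
fixed by all `g(0)`, `g ∈ E`. -/
abbrev Atw (E : u.HomogeneousLift) : Type _ := CyclicModule (twistedIdeal E)

variable {u} in
/-- `CM(𝔲)_E = Cliff(𝔲) ⊗_{ℂE} ℂ`: the `Cliff(𝔲)`-module generated by a vector fixed by `E`. -/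
abbrev CM (E : u.HomogeneousLift) : Type _ :=
  CyclicModule (Submodule.span u.Cliff {a | ∃ g ∈ E.group, a = (g : u.Cliff) - 1})

variable {u} in
/-- `χ_x`: the trace of (left multiplication by) `x` on `CM(𝔲)_E`. -/
def chi (E : u.HomogeneousLift) (x : u.Spin) : ℂ :=
  LinearMap.trace ℂ (CM E) (Algebra.lsmul ℂ ℂ (CM E) (x : u.Cliff))

/-- The even part of a module `Cliff ⧸ J`, that is, the image of the vacuum vector under the even
part of the Clifford algebra (the fixed points of the parity involution). -/
def evenPart {σ : Sector} (J : Submodule (u.HatCliff σ) (u.HatCliff σ)) :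
    Submodule ℂ (CyclicModule J) :=
  (evenOdd (u.hatQuad σ) 0).map ((CyclicModule.mk J).restrictScalars ℂ)

/-! ### The Virasoro operators -/

/-- The fermionic normal ordering `:v(r) w(s):` with `r = m + σ.shift / 2`,
`s = n + σ.shift / 2`. -/
def normalOrder (σ : Sector) (v w : V) (m n : ℤ) : u.HatCliff σ :=
  if m < n then u.mode σ v m * u.mode σ w n
  else if n < m then -(u.mode σ w n * u.mode σ v m)
  else if 2 * m + σ.shift = 0 then
    (1 / 2 : ℂ) • (u.mode σ v m * u.mode σ w n - u.mode σ w n * u.mode σ v m)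
  else u.mode σ v m * u.mode σ w n

theorem exists_mode_smul_eq_zero {σ : Sector} {J : Submodule (u.HatCliff σ) (u.HatCliff σ)}
    (hJ : u.positiveIdeal σ ≤ J) (b : CyclicModule J) :
    ∃ R : ℤ, ∀ (v : V) (m : ℤ), R ≤ m → u.mode σ v m • b = 0 := by
  obtain ⟨a, rfl⟩ := CyclicModule.mk_surjective J b
  suffices h : ∃ R : ℤ, ∀ (v : V) (m : ℤ), R ≤ m → u.mode σ v m * a ∈ J by
    obtain ⟨R, hR⟩ := h
    refine ⟨R, fun v m hm => ?_⟩
    rw [← map_smul, CyclicModule.mk_eq_zero, smul_eq_mul]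
    exact hR v m hm
  induction a using CliffordAlgebra.left_induction with
  | algebraMap r =>
    refine ⟨1, fun v m hm => ?_⟩
    rw [← Algebra.commutes]
    refine J.smul_mem _ (hJ (Submodule.subset_span ⟨v, m, ?_, rfl⟩))
    cases σ <;> simp only [Sector.shift] <;> omega
  | add a b ha hb =>
    obtain ⟨R, hR⟩ := ha
    obtain ⟨S, hS⟩ := hb
    refine ⟨max R S, fun v m hm => ?_⟩
    rw [mul_add]
    exact J.add_mem (hR v m (le_trans (le_max_left _ _) hm))
      (hS v m (le_trans (le_max_right _ _) hm))
  | ι_mul a x ha =>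
    obtain ⟨R, hR⟩ := ha
    obtain ⟨S, hS⟩ : ∃ S : ℤ, ∀ m : ℤ, S ≤ m → x (-m - σ.shift) = 0 := by
      obtain ⟨T, hT⟩ := x.support.bddBelow
      refine ⟨-σ.shift - T + 1, fun m hm => ?_⟩
      by_contra hne
      have h1 := hT (Finset.mem_coe.2 (Finsupp.mem_support_iff.2 hne))
      omega
    refine ⟨max R S, fun v m hm => ?_⟩
    rw [← mul_assoc, mode, ι_mul_ι_swap, hatForm_single, hS m (le_trans (le_max_right _ _) hm)]
    simp only [map_zero, mul_zero, add_zero, neg_mul, mul_assoc]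
    exact J.neg_mem (J.smul_mem _ (hR v m (le_trans (le_max_left _ _) hm)))

theorem finite_support_normalOrder {σ : Sector} {J : Submodule (u.HatCliff σ) (u.HatCliff σ)}
    (hJ : u.positiveIdeal σ ≤ J) (v : V) (k : ℤ) (c : ℤ → ℂ) (b : CyclicModule J) :
    (Function.support fun m : ℤ => c m • u.normalOrder σ v v m (k - m) • b).Finite := by
  obtain ⟨R, hR⟩ := u.exists_mode_smul_eq_zero hJ b
  refine (Set.finite_Icc (k - max R |k|) (max R |k|)).subset fun m hm => ?_
  by_contra hout
  apply hm
  change c m • u.normalOrder σ v v m (k - m) • b = 0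
  have hlt : (k - m < m ∧ R ≤ m) ∨ (m < k - m ∧ R ≤ k - m) := by
    simp only [Set.mem_Icc, not_and_or, not_le] at hout
    have := le_abs_self k
    have := abs_nonneg k
    omega
  rcases hlt with ⟨h1, h2⟩ | ⟨h1, h2⟩
  · rw [normalOrder, if_neg (by omega), if_pos h1, neg_smul, mul_smul, hR v m h2, smul_zero,
      neg_zero, smul_zero]
  · rw [normalOrder, if_pos h1, mul_smul, hR v _ h2, smul_zero, smul_zero]

/-- The coefficient of `z^(-k-2)` in `:v(z) D_z v(z):`, where `v(z) = ∑ v(r) z^(-r-1/2)`.  The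
sum runs over `r = m + σ.shift / 2`; the other mode has degree `k - r`. -/
def quadraticField {σ : Sector} {J : Submodule (u.HatCliff σ) (u.HatCliff σ)}
    (hJ : u.positiveIdeal σ ≤ J) (v : V) (k : ℤ) : Module.End ℂ (CyclicModule J) where
  toFun b := ∑ᶠ m : ℤ, ((m : ℂ) + σ.shift / 2 - k - 1 / 2) •
    u.normalOrder σ v v m (k - σ.shift - m) • b
  map_add' a b := by
    simp only [smul_add]
    exact finsum_add_distrib (u.finite_support_normalOrder hJ v _ _ a)
      (u.finite_support_normalOrder hJ v _ _ b)
  map_smul' c b := by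
    simp only [RingHom.id_apply]
    rw [smul_finsum' c (u.finite_support_normalOrder hJ v _ _ b)]
    refine finsum_congr fun m => ?_
    rw [smul_comm _ c b, smul_comm _ c (_ • b)]

/-- The contribution of `e_i(-1/2) e_i(-3/2) 𝟏` to the correction `exp(Δ_z)` of the twisted vertex
operators: `Δ_z` sends this vector to `(1/4) z^(-2) 𝟏`. -/
def twistCorrection : Sector → ℤ → ℂ
  | .untwisted, _ => 0
  | .twisted, k => if k = 0 then 1 / 4 else 0

/-- The operator `L(k)`, the coefficient of `z^(-k-2)` in `Y(ω, z)`, for the Virasoro element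
`ω = (1/4) ∑ e_i(-1/2) e_i(-3/2) 𝟏`. -/
def virasoro {σ : Sector} {J : Submodule (u.HatCliff σ) (u.HatCliff σ)}
    (hJ : u.positiveIdeal σ ≤ J) (k : ℤ) : Module.End ℂ (CyclicModule J) :=
  (1 / 4 : ℂ) • ∑ i, (u.quadraticField hJ (u.basis i) k + twistCorrection σ k • 1)

theorem normalOrder_even (σ : Sector) (v w : V) (m n : ℤ) :
    u.normalOrder σ v w m n ∈ evenOdd (u.hatQuad σ) 0 := by
  have h : ∀ (v w : V) (m n : ℤ), u.mode σ v m * u.mode σ w n ∈ evenOdd (u.hatQuad σ) 0 :=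
    fun v w m n => ι_mul_ι_mem_evenOdd_zero _ _ _
  unfold normalOrder
  split_ifs
  · exact h _ _ _ _
  · exact Submodule.neg_mem _ (h _ _ _ _)
  · exact Submodule.smul_mem _ _ (Submodule.sub_mem _ (h _ _ _ _) (h _ _ _ _))
  · exact h _ _ _ _

theorem smul_mem_evenPart {σ : Sector} {J : Submodule (u.HatCliff σ) (u.HatCliff σ)}
    {a : u.HatCliff σ} (ha : a ∈ evenOdd (u.hatQuad σ) 0) {b : CyclicModule J}
    (hb : b ∈ u.evenPart J) : a • b ∈ u.evenPart J := by
  obtain ⟨c, hc, rfl⟩ := hb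
  refine ⟨a * c, ?_, rfl⟩
  have h := evenOdd_mul_le (u.hatQuad σ) 0 0 (Submodule.mul_mem_mul ha hc)
  simpa using h

theorem virasoro_mem {σ : Sector} {J : Submodule (u.HatCliff σ) (u.HatCliff σ)}
    (hJ : u.positiveIdeal σ ≤ J) (k : ℤ) {b : CyclicModule J} (hb : b ∈ u.evenPart J) :
    u.virasoro hJ k b ∈ u.evenPart J := by
  have h : ∀ v, u.quadraticField hJ v k b ∈ u.evenPart J := fun v =>
    finsum_induction (· ∈ u.evenPart J) (Submodule.zero_mem _)
      (fun _ _ => Submodule.add_mem _)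
      (fun _ => Submodule.smul_mem _ _ (u.smul_mem_evenPart (u.normalOrder_even _ _ _ _ _) hb))
  simp only [virasoro, LinearMap.smul_apply, LinearMap.sum_apply, LinearMap.add_apply,
    Module.End.one_apply]
  exact Submodule.smul_mem _ _ (Submodule.sum_mem _ fun i _ =>
    Submodule.add_mem _ (h _) (Submodule.smul_mem _ _ hb))

/-! ### The action of the spin group -/

theorem hatAut_positiveIdeal (x : u.Spin) :
    ∀ a ∈ u.positiveIdeal .untwisted,
      (u.hatAut .untwisted x).toLinearMap a ∈ u.positiveIdeal .untwisted := by
  intro a ha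
  rw [AlgHom.toLinearMap_apply]
  induction ha using Submodule.span_induction with
  | mem a h =>
    obtain ⟨v, m, hm, rfl⟩ := h
    rw [hatAut_mode]
    exact Submodule.subset_span ⟨_, m, hm, rfl⟩
  | zero => rw [map_zero]; exact Submodule.zero_mem _
  | add a b _ _ ha hb => rw [map_add]; exact Submodule.add_mem _ ha hb
  | smul c a _ ha => rw [smul_eq_mul, map_mul]; exact Submodule.smul_mem _ _ ha

/-- The action of `x ∈ Spin(𝔲)` on `A(𝔲)`: the vacuum is fixed and `v(r) ↦ (x v x⁻¹)(r)`. -/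
def actA (x : u.Spin) : Module.End ℂ u.A :=
  CyclicModule.mapEnd _ (u.hatAut .untwisted x).toLinearMap (u.hatAut_positiveIdeal x)

theorem actA_mk (x : u.Spin) (a : u.HatCliff .untwisted) :
    u.actA x (CyclicModule.mk _ a) = CyclicModule.mk _ (u.hatAut .untwisted x a) := rfl

variable {u} in
/-- The map `a ↦ x(a) x` of `Cliff(𝔲̂_θ)`, where `x(·)` is the automorphism induced by `x`. -/
def twistedMap (x : u.Spin) : u.HatCliff .twisted →ₗ[ℂ] u.HatCliff .twisted :=
  LinearMap.mulRight ℂ (u.zeroEmb (x : u.Cliff)) ∘ₗ (u.hatAut .twisted x).toLinearMap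

variable {u} in
theorem twistedMap_twistedIdeal (E : u.HomogeneousLift) (x : u.Spin) :
    ∀ a ∈ twistedIdeal E, twistedMap x a ∈ twistedIdeal E := by
  intro a ha
  change u.hatAut .twisted x a * u.zeroEmb (x : u.Cliff) ∈ twistedIdeal E
  rw [twistedIdeal, positiveIdeal, ← Submodule.span_union] at ha
  induction ha using Submodule.span_induction with
  | mem a h =>
    rcases h with ⟨v, m, hm, rfl⟩ | ⟨g, hg, rfl⟩
    · have hm0 : m ≠ 0 := by
        rintro rfl
        simp [Sector.shift] at hm
      rw [hatAut_mode, u.zeroEmb_comm (spinGroup.mem_even x.2) _ hm0]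
      exact Submodule.smul_mem _ _ (Submodule.mem_sup_left (Submodule.subset_span ⟨_, m, hm, rfl⟩))
    · rw [map_sub, map_one, hatAut_zeroEmb, sub_mul, one_mul, ← map_mul, mul_assoc, coe_inv_mul,
        mul_one, map_mul, ← mul_sub_one]
      exact Submodule.smul_mem _ _ (Submodule.mem_sup_right (Submodule.subset_span ⟨g, hg, rfl⟩))
  | zero => rw [map_zero, zero_mul]; exact Submodule.zero_mem _
  | add a b _ _ ha hb => rw [map_add, add_mul]; exact Submodule.add_mem _ ha hb
  | smul c a _ ha =>
    rw [smul_eq_mul, map_mul, mul_assoc]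
    exact Submodule.smul_mem _ _ ha

variable {u} in
/-- The action of `x ∈ Spin(𝔲)` on `A(𝔲)_{θ,E}`: one has `x · (v(r) b) = (x v x⁻¹)(r) (x · b)`,
and `x` acts on the vacuum vector as the element `x` of `Cliff(𝔲) ⊆ Cliff(𝔲̂_θ)`. -/
def actAtw (E : u.HomogeneousLift) (x : u.Spin) : Module.End ℂ (Atw E) :=
  CyclicModule.mapEnd _ (twistedMap x) (twistedMap_twistedIdeal E x)

variable {u} in
theorem actAtw_mk (E : u.HomogeneousLift) (x : u.Spin) (a : u.HatCliff .twisted) :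
    actAtw E x (CyclicModule.mk _ a) =
      CyclicModule.mk _ (u.hatAut .twisted x a * u.zeroEmb (x : u.Cliff)) := rfl

/-! ### The twisted construction -/

variable {u} in
/-- The space `A^f(𝔲) = A(𝔲)⁰ ⊕ A(𝔲)⁰_{θ,E}`. -/
abbrev Af (E : u.HomogeneousLift) : Type _ :=
  ↥(u.evenPart (u.positiveIdeal .untwisted)) × ↥(u.evenPart (twistedIdeal E))

variable {u} in
/-- The operator `L(0)` on `A^f(𝔲)`. -/
def L0 (E : u.HomogeneousLift) : Module.End ℂ (Af E) :=
  LinearMap.prodMap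
    ((u.virasoro (le_refl (u.positiveIdeal .untwisted)) 0).restrict
      fun _ hb => u.virasoro_mem _ 0 hb)
    ((u.virasoro (le_sup_left : u.positiveIdeal .twisted ≤ twistedIdeal E) 0).restrict
      fun _ hb => u.virasoro_mem _ 0 hb)

theorem actA_mem (x : u.Spin) {b : u.A} (hb : b ∈ u.evenPart (u.positiveIdeal .untwisted)) :
    u.actA x b ∈ u.evenPart (u.positiveIdeal .untwisted) := by
  obtain ⟨a, ha, rfl⟩ := hb
  exact ⟨_, u.hatAut_even _ x ha, rfl⟩

variable {u} in
theorem actAtw_mem (E : u.HomogeneousLift) (x : u.Spin) {b : Atw E}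
    (hb : b ∈ u.evenPart (twistedIdeal E)) : actAtw E x b ∈ u.evenPart (twistedIdeal E) := by
  obtain ⟨a, ha, rfl⟩ := hb
  refine ⟨_, ?_, (actAtw_mk E x a).symm⟩
  have h := evenOdd_mul_le (u.hatQuad .twisted) 0 0
    (Submodule.mul_mem_mul (u.hatAut_even .twisted x ha) (u.zeroEmb_even (spinGroup.mem_even x.2)))
  simpa using h

variable {u} in
/-- The action of `Spin(𝔲)` on `A^f(𝔲)`. -/
def spinAct (E : u.HomogeneousLift) : u.Spin →* Module.End ℂ (Af E) where
  toFun x := LinearMap.prodMap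
    ((u.actA x).restrict fun _ hb => u.actA_mem x hb)
    ((actAtw E x).restrict fun _ hb => actAtw_mem E x hb)
  map_one' := by
    have h1 : u.actA 1 = 1 := by
      ext b
      obtain ⟨a, rfl⟩ := CyclicModule.mk_surjective _ b
      rw [actA_mk, hatAut_one]; rfl
    have h2 : actAtw E 1 = 1 := by
      ext b
      obtain ⟨a, rfl⟩ := CyclicModule.mk_surjective _ b
      rw [actAtw_mk, hatAut_one, OneMemClass.coe_one, map_one, mul_one]; rfl
    refine LinearMap.ext fun p => Prod.ext (Subtype.ext ?_) (Subtype.ext ?_)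
    · exact congrArg (fun f => f p.1.1) h1
    · exact congrArg (fun f => f p.2.1) h2
  map_mul' x y := by
    have h1 : ∀ b, u.actA (x * y) b = u.actA x (u.actA y b) := by
      intro b
      obtain ⟨a, rfl⟩ := CyclicModule.mk_surjective _ b
      rw [actA_mk, actA_mk, actA_mk, hatAut_mul]
    have h2 : ∀ b, actAtw E (x * y) b = actAtw E x (actAtw E y b) := by
      intro b
      obtain ⟨a, rfl⟩ := CyclicModule.mk_surjective _ b
      rw [actAtw_mk, actAtw_mk, actAtw_mk, hatAut_mul, map_mul (u.hatAut .twisted x),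
        hatAut_zeroEmb, mul_assoc, ← map_mul u.zeroEmb, mul_assoc _ _ (x : u.Cliff), coe_inv_mul,
        mul_one, Submonoid.coe_mul]
    exact LinearMap.ext fun p => Prod.ext (Subtype.ext (h1 p.1.1)) (Subtype.ext (h2 p.2.1))

/-! ### The central element and the quotient of the spin group -/

theorem ι_basis_mul_prod (j : Fin (2 * N)) (l : List (Fin (2 * N))) :
    ι u.quad (u.basis j) * (l.map fun i => ι u.quad (u.basis i)).prod =
      (-1 : ℂ) ^ (l.countP fun i => decide (i ≠ j)) •
        ((l.map fun i => ι u.quad (u.basis i)).prod * ι u.quad (u.basis j)) := by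
  induction l with
  | nil => simp
  | cons i l ih =>
    rw [List.map_cons, List.prod_cons]
    by_cases hij : i = j
    · subst hij
      rw [List.countP_cons_of_neg (by simp), mul_assoc, ← mul_smul_comm, ← ih]
    · have hs : ι u.quad (u.basis j) * ι u.quad (u.basis i) =
          -(ι u.quad (u.basis i) * ι u.quad (u.basis j)) := by
        have h := ι_mul_ι_add_swap (Q := u.quad) (u.basis j) (u.basis i)
        have hp : QuadraticMap.polar u.quad (u.basis j) (u.basis i) = 0 := by
          simp only [QuadraticMap.polar, quad_apply, map_add, LinearMap.add_apply, u.orthonormal,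
            if_neg hij, if_neg (Ne.symm hij)]
          ring
        rw [hp, map_zero] at h
        exact eq_neg_of_add_eq_zero_left h
      rw [List.countP_cons_of_pos (by simpa using hij), pow_succ, ← mul_assoc, hs, neg_mul,
        mul_assoc, ih, mul_smul_comm, mul_neg_one, neg_smul, mul_assoc]

theorem ι_mul_monomial_univ (v : V) :
    ι u.quad v * u.monomial Finset.univ = -(u.monomial Finset.univ * ι u.quad v) := by
  have h : LinearMap.mulRight ℂ (u.monomial Finset.univ) ∘ₗ ι u.quad =
      -(LinearMap.mulLeft ℂ (u.monomial Finset.univ) ∘ₗ ι u.quad) := by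
    refine u.basis.ext fun j => ?_
    change ι u.quad (u.basis j) * u.monomial Finset.univ =
      -(u.monomial Finset.univ * ι u.quad (u.basis j))
    unfold monomial
    rw [ι_basis_mul_prod]
    have hc : ((Finset.univ : Finset (Fin (2 * N))).sort (· ≤ ·)).countP
        (fun i => decide (i ≠ j)) + 1 = 2 * N := by
      have h1 := List.length_eq_countP_add_countP (fun i => decide (i ≠ j))
        (l := (Finset.univ : Finset (Fin (2 * N))).sort (· ≤ ·))
      have h2 : ((Finset.univ : Finset (Fin (2 * N))).sort (· ≤ ·)).count j = 1 :=
        List.count_eq_one_of_mem (Finset.sort_nodup _ _) (by simp)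
      rw [Finset.length_sort, Finset.card_univ, Fintype.card_fin] at h1
      refine Eq.trans ?_ h1.symm
      congr 1
      rw [← h2, List.count]
      congr 1
      funext i
      by_cases hi : i = j <;> simp [hi]
    have ho : Odd (((Finset.univ : Finset (Fin (2 * N))).sort (· ≤ ·)).countP
        (fun i => decide (i ≠ j))) := ⟨N - 1, by omega⟩
    rw [ho.neg_one_pow, neg_one_smul]
  exact congrArg (fun f => f v) h

theorem monomial_univ_mem : u.monomial Finset.univ ∈ spinGroup u.quad := by
  have hsq : ∀ i, ι u.quad (u.basis i) * ι u.quad (u.basis i) = -1 := by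
    intro i
    rw [ι_sq_scalar, quad_apply, u.orthonormal, if_pos rfl, map_neg, map_one]
  refine ⟨Submonoid.list_prod_mem _ fun a ha => ?_, ?_⟩
  · obtain ⟨i, -, rfl⟩ := List.mem_map.1 ha
    refine ⟨⟨⟨ι u.quad (u.basis i), -ι u.quad (u.basis i), ?_, ?_⟩,
      Subgroup.subset_closure ⟨u.basis i, rfl⟩, rfl⟩, ?_, ?_⟩
    · rw [mul_neg, hsq, neg_neg]
    · rw [neg_mul, hsq, neg_neg]
    · rw [star_ι, neg_mul, hsq, neg_neg]
    · rw [star_ι, mul_neg, hsq, neg_neg]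
  · change u.monomial Finset.univ ∈ evenOdd u.quad 0
    have h : ∀ l : List (Fin (2 * N)),
        (l.map fun i => ι u.quad (u.basis i)).prod ∈ evenOdd u.quad (l.length : ZMod 2) := by
      intro l
      induction l with
      | nil => simpa using one_le_evenOdd_zero u.quad (Submodule.mem_one.2 ⟨1, map_one _⟩)
      | cons i l ih =>
        rw [List.map_cons, List.prod_cons, List.length_cons, Nat.cast_add, Nat.cast_one, add_comm]
        exact evenOdd_mul_le _ _ _ (Submodule.mul_mem_mul (ι_mem_evenOdd_one _ _) ih)
    have h0 := h ((Finset.univ : Finset (Fin (2 * N))).sort (· ≤ ·))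
    have hl : ((2 * N : ℕ) : ZMod 2) = 0 := (ZMod.natCast_eq_zero_iff _ _).2 ⟨N, rfl⟩
    rwa [Finset.length_sort, Finset.card_univ, Fintype.card_fin, hl] at h0

/-- The element `𝔷 = e_Σ` of `Spin(𝔲)`. -/
def z : u.Spin := ⟨u.monomial Finset.univ, u.monomial_univ_mem⟩

theorem toSO_z : u.toSO u.z = -LinearMap.id := by
  ext v
  apply u.ι_injective
  have h := u.ι_mul_monomial_univ v
  rw [ι_toSO, LinearMap.neg_apply, LinearMap.id_apply, map_neg]
  change u.monomial Finset.univ * ι u.quad v * ((u.z⁻¹ : u.Spin) : u.Cliff) = -ι u.quad v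
  rw [← neg_eq_iff_eq_neg.2 h, neg_mul, mul_assoc]
  rw [show u.monomial Finset.univ * ((u.z⁻¹ : u.Spin) : u.Cliff) = 1 from u.coe_mul_inv u.z,
    mul_one]

theorem z_comm (x : u.Spin) : u.z * x = x * u.z := by
  have h : ∀ a ∈ evenOdd u.quad 0, u.monomial Finset.univ * a = a * u.monomial Finset.univ := by
    intro a ha
    induction a, ha using CliffordAlgebra.even_induction with
    | algebraMap r => rw [Algebra.commutes]
    | add a b _ _ ha hb => rw [mul_add, add_mul, ha, hb]
    | ι_mul_ι_mul a b c _ hc =>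
      have h1 : ∀ v, u.monomial Finset.univ * ι u.quad v =
          -(ι u.quad v * u.monomial Finset.univ) := fun v => by
        rw [ι_mul_monomial_univ, neg_neg]
      rw [mul_assoc, ← mul_assoc, h1 a, neg_mul, mul_assoc, ← mul_assoc (u.monomial _), h1 b,
        neg_mul, mul_neg, neg_neg, mul_assoc (ι u.quad b), hc]
      simp only [mul_assoc]
  exact Subtype.ext (h _ (spinGroup.mem_even x.2))

instance : (Subgroup.zpowers u.z).Normal where
  conj_mem n hn g := by
    obtain ⟨k, rfl⟩ := Subgroup.mem_zpowers_iff.1 hn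
    have h : Commute u.z g := u.z_comm g
    rw [(h.zpow_left k).symm.eq, mul_assoc, mul_inv_cancel, mul_one]
    exact hn

/-- The group `Spin(𝔲)/⟨𝔷⟩`. -/
abbrev SpinQuot : Type _ := u.Spin ⧸ Subgroup.zpowers u.z

theorem hatAut_z {σ : Sector} {a : u.HatCliff σ} (ha : a ∈ evenOdd (u.hatQuad σ) 0) :
    u.hatAut σ u.z a = a := by
  have h : u.hatAut σ u.z = involute := by
    apply CliffordAlgebra.hom_ext
    ext m v
    change u.hatAut σ u.z (u.mode σ v m) = involute (ι (u.hatQuad σ) (Finsupp.single m v))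
    rw [hatAut_mode, toSO_z, involute_ι, mode]
    simp
  rw [h]
  exact involute_eq_of_mem_even ha

variable {u} in
theorem spinAct_z (E : u.HomogeneousLift) : spinAct E u.z = 1 := by
  have h1 : ∀ b ∈ u.evenPart (u.positiveIdeal .untwisted), u.actA u.z b = b := by
    rintro _ ⟨a, ha, rfl⟩
    change u.actA u.z (CyclicModule.mk _ a) = CyclicModule.mk _ a
    rw [actA_mk, hatAut_z u ha]
  have h2 : ∀ b ∈ u.evenPart (twistedIdeal E), actAtw E u.z b = b := by
    rintro _ ⟨a, ha, rfl⟩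
    change actAtw E u.z (CyclicModule.mk _ a) = CyclicModule.mk _ a
    rw [actAtw_mk, hatAut_z u ha, ← sub_eq_zero, ← map_sub, CyclicModule.mk_eq_zero,
      ← mul_sub_one]
    obtain ⟨g, hg, hgz⟩ := E.top_mem
    refine Submodule.smul_mem _ _ (Submodule.mem_sup_right (Submodule.subset_span ⟨g, hg, ?_⟩))
    rw [hgz]; rfl
  exact LinearMap.ext fun p =>
    Prod.ext (Subtype.ext (h1 p.1.1 p.1.2)) (Subtype.ext (h2 p.2.1 p.2.2))

variable {u} in
/-- The action of `Spin(𝔲)/⟨𝔷⟩` on `A^f(𝔲)`. -/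
def act (E : u.HomogeneousLift) : u.SpinQuot →* Module.End ℂ (Af E) :=
  QuotientGroup.lift (Subgroup.zpowers u.z) (spinAct E) fun x hx => by
    obtain ⟨k, rfl⟩ := Subgroup.mem_zpowers_iff.1 hx
    have h := Subgroup.zpow_mem (spinAct E).ker (MonoidHom.mem_ker.2 (spinAct_z E)) k
    exact MonoidHom.mem_ker.1 h

end OrthoSpace

/-! ### McKay-Thompson series, Frame shapes and eta products -/

/-- `f` is the McKay-Thompson series `∑ₙ tr(g | Uₙ) q^(n - c/24)`, `q = exp(2πiτ)`, of `g` acting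
on `U`, where `Uₙ` is the eigenspace of `L₀` for the eigenvalue `n`: the operator `L₀` is
diagonalizable with rational eigenvalues and finite-dimensional eigenspaces, all preserved by `g`,
and the series converges to `f τ` for every `τ` in the upper half plane. -/
def HasMcKayThompsonSeries {U : Type*} [AddCommGroup U] [Module ℂ U] (L₀ g : Module.End ℂ U)
    (c : ℂ) (f : UpperHalfPlane → ℂ) : Prop :=
  DirectSum.IsInternal (fun n : ℚ => L₀.eigenspace (n : ℂ)) ∧
  (∀ n : ℚ, FiniteDimensional ℂ (L₀.eigenspace (n : ℂ))) ∧
  ∃ hg : ∀ n : ℚ, ∀ v ∈ L₀.eigenspace (n : ℂ), g v ∈ L₀.eigenspace (n : ℂ),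
    ∀ τ : UpperHalfPlane,
      HasSum (fun n : ℚ => LinearMap.trace ℂ _ (g.restrict (hg n)) *
        Complex.exp (2 * Real.pi * Complex.I * (τ : ℂ) * ((n : ℂ) - c / 24))) (f τ)

/-- `h` admits the Frame shape `∏_{k ∣ n} k^(m k)`: one has
`det(Id - h x) = ∏_{k ∣ n} (1 - x^k)^(m k)` as rational functions of `x`. -/
def HasFrameShape {V : Type*} [AddCommGroup V] [Module ℂ V] (h : V →ₗ[ℂ] V) (n : ℕ) (m : ℕ → ℤ) :
    Prop :=
  0 < n ∧ ∀ x : ℂ, x ^ n ≠ 1 →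
    LinearMap.det (LinearMap.id - x • h) = ∏ k ∈ n.divisors, (1 - x ^ k) ^ m k

/-- The eta product `∏_{k ∣ n} η(k τ)^(m k)` of the Frame shape `∏_{k ∣ n} k^(m k)`. -/
def etaProduct (n : ℕ) (m : ℕ → ℤ) (τ : ℂ) : ℂ :=
  ∏ k ∈ n.divisors, ModularForm.eta (k * τ) ^ m k

end

end CliffordVOA

/-! Both summands are even parts of fermionic Fock spaces, on which graded traces are infinite
products. As a vector space, `A(𝔲)` is the exterior algebra on the creation modes `v(-r)`, `r = 1/2,
3/2, …`, and `A(𝔲)_{θ,E}` is `CM(𝔲)_E` tensored with the exterior algebra on those with `r = 1, 2,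
…` (`GroundStates.fockEquiv`). Because `[L(0), v(r)] = -r v(r)` (`virasoro_mode_smul`), a product of
creation modes raises the weight by the sum of its `r`, starting from the ground weight `0`,
respectively `N/8`.

The trace of `x` on an exterior algebra needs only a triangular basis for its image in `SO(𝔲)`: the
diagonal coefficient at a subset is the product of the diagonal entries it selects. Summing over
finite subsets gives `q^(-N/24) ∏ det(1 + q^(j+1/2) ḡ)` on `A(𝔲)` and `χ_ĝ q^(N/8-N/24) ∏ det(1 +
q^(j+1) ḡ)` on `A(𝔲)_{θ,E}` (`hasEigenbasisTrace_of_groundStates`).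

Since `1 + q^r ḡ = 1 - q^r (-ḡ)`, the Frame shape of `-ḡ` turns these into `η_{-ḡ}(τ/2)/η_{-ḡ}(τ)`
and `χ_ĝ η_{-ḡ}(τ)` (`HasFrameShape.etaProduct_div_eq`, `HasFrameShape.etaProduct_eq`). The powers
of `q` in front agree because a Frame shape satisfies `∑ k m_k = dim 𝔲 = 2N`
(`HasFrameShape.sum_eq`).

Finally, `𝔷` acts on both Fock spaces as the parity involution: it is `-1` on `𝔲`, and `e_Σ ∈ E`
fixes `𝟏_E`. Hence `(1 + 𝔷)/2` projects to the even part, and the trace of `ĝ` there is the average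
of the traces of `ĝ` and `𝔷ĝ` (`hasMcKayThompsonSeries_spinAct`). As `𝔷ĝ` maps to `-ḡ`, its traces
involve the Frame shape of `ḡ`, which accounts for all four terms. -/

namespace CliffordVOA
noncomputable section

/-! ### Triangular bases and diagonal coefficients on exterior algebras -/

/-- Over `ℂ`, every endomorphism is triangular in a suitable basis. -/
theorem exists_triangular_basis (d : ℕ) : ∀ {V : Type*} [AddCommGroup V] [Module ℂ V]
    [FiniteDimensional ℂ V] (_ : Module.finrank ℂ V = d) (h : V →ₗ[ℂ] V),
    ∃ b : Module.Basis (Fin d) ℂ V, ∀ i j, j < i → b.repr (h (b i)) j = 0 := by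
  induction d with
  | zero =>
    intro V _ _ _ hV h
    exact ⟨Module.finBasisOfFinrankEq ℂ V hV, fun i => i.elim0⟩
  | succ d ih =>
    intro V _ _ _ hV h
    have : Nontrivial V := Module.nontrivial_of_finrank_eq_succ hV
    -- An eigenvector `φ` of the transpose has an `h`-invariant kernel of codimension one. The
    -- induction handles this hyperplane, and a vector `y` outside it is put first, where no
    -- condition is imposed on it.
    obtain ⟨μ, hμ⟩ := Module.End.exists_eigenvalue (Module.Dual.transpose (R := ℂ) h)
    obtain ⟨φ, hφ, hφ0⟩ := hμ.exists_hasEigenvector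
    rw [Module.End.mem_eigenspace_iff] at hφ
    have hφh : ∀ v, φ (h v) = μ * φ v := fun v => congrArg (fun f => f v) hφ
    have hk : Module.finrank ℂ (LinearMap.ker φ) = d := by
      have := Module.Dual.finrank_ker_add_one_of_ne_zero hφ0
      omega
    have hinv : ∀ v ∈ LinearMap.ker φ, h v ∈ LinearMap.ker φ := by
      intro v hv
      rw [LinearMap.mem_ker] at hv ⊢
      rw [hφh, hv, mul_zero]
    obtain ⟨b, hb⟩ := ih hk (h.restrict hinv)
    obtain ⟨y, hy⟩ : ∃ y, φ y = 1 := by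
      obtain ⟨y, hy⟩ := DFunLike.ne_iff.1 hφ0
      exact ⟨(φ y)⁻¹ • y, by simpa using inv_mul_cancel₀ hy⟩
    have hli : ∀ (c : ℂ), ∀ x ∈ LinearMap.ker φ, c • y + x = 0 → c = 0 := by
      intro c x hx hc
      have := congrArg φ hc
      rw [LinearMap.mem_ker] at hx
      simpa [hy, hx] using this
    have hsp : ∀ z : V, ∃ c : ℂ, z + c • y ∈ LinearMap.ker φ := fun z =>
      ⟨-φ z, by simp [hy]⟩
    let B := Module.Basis.mkFinCons y b hli hsp
    have hB : ∀ i : Fin d, B i.succ = b i := fun i => by simp [B]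
    have hr0 : B.coord 0 ∘ₗ Submodule.subtype _ = 0 := b.ext fun i => by
      simp [← hB]
    have hr : ∀ j : Fin d, B.coord j.succ ∘ₗ Submodule.subtype _ = b.coord j := fun j =>
      b.ext fun i => by
        simp [← hB, Finsupp.single_apply]
    refine ⟨B, fun i j hij => ?_⟩
    obtain ⟨i, rfl⟩ := Fin.exists_succ_eq.2 (Fin.ne_zero_of_lt hij)
    have h1 : h (B i.succ) = ((h.restrict hinv (b i) : LinearMap.ker φ) : V) := by
      rw [hB]; rfl
    rw [h1]
    refine Fin.cases (fun _ => congrArg (fun f => f (h.restrict hinv (b i))) hr0) (fun j hij => ?_) j hij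
    exact (congrArg (fun f => f (h.restrict hinv (b i))) (hr j)).trans (hb i j (Fin.succ_lt_succ_iff.1 hij))

/-- The basis of the whole exterior algebra is glued from those of the exterior powers, whose
coordinates are determinants of coordinate functionals; this gives access to those determinants. -/
theorem exteriorAlgebra_repr_coe {I W : Type*} [LinearOrder I] [AddCommGroup W] [Module ℂ W]
    (b : Module.Basis I ℂ W) {n : ℕ} (s : Set.powersetCard I n) (x : ⋀[ℂ]^n W) :
    b.ExteriorAlgebra.repr (x : ExteriorAlgebra ℂ W) s = (b.exteriorPower n).repr x s := by
  have h : b.ExteriorAlgebra.coord s ∘ₗ Submodule.subtype _ = (b.exteriorPower n).coord s := by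
    refine (b.exteriorPower n).ext fun t => ?_
    rw [LinearMap.comp_apply, Submodule.subtype_apply, ← ExteriorAlgebra.basis_eq_coe_basis,
      Module.Basis.coord_apply, Module.Basis.coord_apply, Module.Basis.repr_self,
      Module.Basis.repr_self, Finsupp.single_apply, Finsupp.single_apply]
    simp only [Subtype.coe_inj]
  exact congrArg (fun f => f x) h

/-- The diagonal coefficients of the exterior algebra of a triangular endomorphism. -/
theorem exteriorAlgebra_repr_map_self {I W : Type*} [LinearOrder I] [AddCommGroup W] [Module ℂ W]
    (b : Module.Basis I ℂ W) (H : W →ₗ[ℂ] W) (hH : ∀ i j, j < i → b.repr (H (b i)) j = 0)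
    (S : Finset I) :
    b.ExteriorAlgebra.repr (ExteriorAlgebra.map H (b.ExteriorAlgebra S)) S =
      ∏ i ∈ S, b.repr (H (b i)) i := by
  suffices h : ∀ (n : ℕ) (s : Set.powersetCard I n),
      b.ExteriorAlgebra.repr (ExteriorAlgebra.map H (b.ExteriorAlgebra s)) s =
        ∏ i ∈ (s : Finset I), b.repr (H (b i)) i from h _ ⟨S, rfl⟩
  intro n s
  have h1 : ExteriorAlgebra.map H (ExteriorAlgebra.ιMulti_family ℂ n b s) =
      ((exteriorPower.ιMulti ℂ n (H ∘ b ∘ Set.powersetCard.ofFinEmbEquiv.symm s) : ⋀[ℂ]^n W) :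
        ExteriorAlgebra ℂ W) := by
    rw [ExteriorAlgebra.ιMulti_family, ExteriorAlgebra.map_apply_ιMulti]
    rfl
  rw [ExteriorAlgebra.basis_apply_powersetCard, h1, exteriorAlgebra_repr_coe,
    exteriorPower.basis_repr_apply, exteriorPower.ιMultiDual_apply_ιMulti]
  -- The coefficient is the principal minor of `H` on the indices in `s`. As `s` is enumerated
  -- increasingly, the minor inherits the triangular shape and only its diagonal matters.
  have ht : Matrix.BlockTriangular (Matrix.of fun i j => b.coord
      (Set.powersetCard.ofFinEmbEquiv.symm s j)
      ((H ∘ b ∘ Set.powersetCard.ofFinEmbEquiv.symm s) i)) id := by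
    intro i j hij
    exact hH _ _ ((Set.powersetCard.ofFinEmbEquiv.symm s).strictMono hij)
  rw [Matrix.det_of_isUpperTriangular ht]
  simp only [Matrix.of_apply, Module.Basis.coord_apply, Function.comp_apply]
  have hs : (s : Finset I) =
      Finset.univ.map (Set.powersetCard.ofFinEmbEquiv.symm s).toEmbedding := by
    ext i
    have := Set.powersetCard.mem_range_ofFinEmbEquiv_symm_iff_mem s i
    simp only [Finset.mem_map, Finset.mem_univ, true_and]
    exact this.symm
  rw [hs, Finset.prod_map]
  rfl

/-! ### Graded traces computed from eigenbases -/

section McKay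

theorem _root_.HasSum.congr_fun' {α β : Type*} [AddCommMonoid α] [TopologicalSpace α]
    {f g : β → α} {a : α} (h : HasSum f a) (hfg : ∀ i, g i = f i) : HasSum g a :=
  (funext hfg : g = f) ▸ h

variable {U : Type*} [AddCommGroup U] [Module ℂ U] {L g : Module.End ℂ U}

theorem isInternal_eigenspace_of_iSup_eq_top
    (h : ⨆ n : ℚ, L.eigenspace (n : ℂ) = ⊤) :
    DirectSum.IsInternal (fun n : ℚ => L.eigenspace (n : ℂ)) :=
  DirectSum.isInternal_submodule_of_iSupIndep_of_iSup_eq_top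
    (L.eigenspaces_iSupIndep.comp (f := fun n : ℚ => (n : ℂ)) Rat.cast_injective) h

/-- The trace of an operator on an eigenspace, in terms of a basis of eigenvectors. -/
theorem trace_restrict_eigenspace {β : Type*} (b : Module.Basis β ℂ U) (w : β → ℚ)
    (hw : ∀ n, (w ⁻¹' {n}).Finite) (hb : ∀ i, L (b i) = (w i : ℂ) • b i) (n : ℚ)
    (hg : ∀ v ∈ L.eigenspace (n : ℂ), g v ∈ L.eigenspace (n : ℂ)) :
    FiniteDimensional ℂ (L.eigenspace (n : ℂ)) ∧
    LinearMap.trace ℂ _ (g.restrict hg) =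
      ∑ᶠ i : w ⁻¹' {n}, b.repr (g (b i)) i := by
  classical
  -- Each coordinate functional satisfies `coord i ∘ L = w i • coord i`, so on an `n`-eigenvector it
  -- is multiplied by both `n` and `w i`. Hence the basis vectors of weight `n` span the eigenspace.
  have hrepr : ∀ v, v ∈ L.eigenspace (n : ℂ) → ∀ i, w i ≠ n → b.repr v i = 0 := by
    intro v hv i hi
    have h1 : b.coord i ∘ₗ L = (w i : ℂ) • b.coord i := b.ext fun j => by
      simp only [LinearMap.comp_apply, hb, map_smul, LinearMap.smul_apply,
        Module.Basis.coord_apply, Module.Basis.repr_self, Finsupp.single_apply]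
      split_ifs with h
      · rw [h]
      · simp
    have h2 := congrArg (fun f => f v) h1
    simp only [LinearMap.comp_apply, Module.End.mem_eigenspace_iff.1 hv, map_smul,
      LinearMap.smul_apply, Module.Basis.coord_apply, smul_eq_mul] at h2
    have h3 : ((n : ℂ) - w i) * b.repr v i = 0 := by rw [sub_mul, h2, sub_self]
    refine (mul_eq_zero.1 h3).resolve_left (sub_ne_zero.2 fun h => hi ?_)
    exact (Rat.cast_injective h).symm
  let c : w ⁻¹' {n} → L.eigenspace (n : ℂ) := fun i => ⟨b i, by
    rw [Module.End.mem_eigenspace_iff, hb, show w i = n from i.2]⟩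
  have hli : LinearIndependent ℂ c := by
    refine LinearIndependent.of_comp (L.eigenspace (n : ℂ)).subtype ?_
    exact b.linearIndependent.comp _ Subtype.val_injective
  have hsp : ⊤ ≤ Submodule.span ℂ (Set.range c) := by
    rintro v -
    have : (v : U) ∈ (Submodule.span ℂ (Set.range c)).map (L.eigenspace (n : ℂ)).subtype := by
      rw [← b.linearCombination_repr (v : U), Finsupp.linearCombination_apply]
      refine Submodule.sum_mem _ fun i _ => ?_
      by_cases hi : w i = n
      · exact Submodule.smul_mem _ _ ⟨c ⟨i, hi⟩, Submodule.subset_span ⟨_, rfl⟩, rfl⟩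
      · dsimp only
        rw [hrepr v v.2 i hi, zero_smul]
        exact Submodule.zero_mem _
    obtain ⟨v', hv', h⟩ := this
    rwa [← Subtype.ext h]
  let C := Module.Basis.mk hli hsp
  have hC : ∀ i (v : L.eigenspace (n : ℂ)), C.repr v i = b.repr (v : U) i := by
    intro i v
    have h : C.coord i = b.coord (i : β) ∘ₗ Submodule.subtype _ := C.ext fun j => by
      rw [Module.Basis.coord_apply, Module.Basis.repr_self, LinearMap.comp_apply,
        Module.Basis.mk_apply, Submodule.subtype_apply, Module.Basis.coord_apply,
        Module.Basis.repr_self, Finsupp.single_apply, Finsupp.single_apply]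
      simp only [Subtype.coe_inj]
    exact congrArg (fun f => f v) h
  have := (hw n).fintype
  refine ⟨C.finiteDimensional_of_finite, ?_⟩
  rw [LinearMap.trace_eq_matrix_trace ℂ C, Matrix.trace, finsum_eq_sum_of_fintype]
  refine Finset.sum_congr rfl fun i _ => ?_
  rw [Matrix.diag_apply, LinearMap.toMatrix_apply, hC, Module.Basis.mk_apply]
  rfl

/-- The index set is fibred over its weights; each finite fibre contributes the trace on one
eigenspace times a common power of `q`. Summing first within the fibres turns the sum over the basis
into the series over `ℚ`. -/
theorem hasMcKayThompsonSeries_of_basis {β : Type*} (b : Module.Basis β ℂ U) (w : β → ℚ)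
    (hw : ∀ n, (w ⁻¹' {n}).Finite) (hb : ∀ i, L (b i) = (w i : ℂ) • b i) (hLg : Commute L g)
    (c : ℂ) (f : UpperHalfPlane → ℂ)
    (hf : ∀ τ : UpperHalfPlane, HasSum (fun i => b.repr (g (b i)) i *
      Complex.exp (2 * Real.pi * Complex.I * (τ : ℂ) * ((w i : ℂ) - c / 24))) (f τ)) :
    HasMcKayThompsonSeries L g c f := by
  have hg : ∀ n : ℚ, ∀ v ∈ L.eigenspace (n : ℂ), g v ∈ L.eigenspace (n : ℂ) := by
    intro n v hv
    rw [Module.End.mem_eigenspace_iff] at hv ⊢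
    rw [← Module.End.mul_apply, hLg.eq, Module.End.mul_apply, hv, map_smul]
  refine ⟨isInternal_eigenspace_of_iSup_eq_top ?_,
    fun n => (trace_restrict_eigenspace b w hw hb n (hg n)).1, hg, fun τ => ?_⟩
  · rw [eq_top_iff, ← b.span_eq, Submodule.span_le]
    rintro _ ⟨i, rfl⟩
    exact Submodule.mem_iSup_of_mem (w i) (Module.End.mem_eigenspace_iff.2 (hb i))
  · have h := (Equiv.sigmaFiberEquiv w).hasSum_iff.2 (hf τ)
    refine h.sigma fun n => ?_
    have : Fintype {i // w i = n} := (hw n).fintype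
    rw [(trace_restrict_eigenspace b w hw hb n (hg n)).2]
    have h2 := hasSum_fintype (fun i : {i // w i = n} => b.repr (g (b i)) i *
      Complex.exp (2 * Real.pi * Complex.I * (τ : ℂ) * ((n : ℂ) - c / 24)))
    rw [← Finset.sum_mul] at h2
    rw [← finsum_eq_sum_of_fintype] at h2
    refine h2.congr_fun' fun i => ?_
    simp [Equiv.sigmaFiberEquiv, i.2]

/-- `L` has a basis of eigenvectors with rational eigenvalues of finite multiplicities, `g` commutes
with `L`, and the diagonal coefficients of `g q^(L - c/24)` in this basis sum to `f`. -/
def HasEigenbasisTrace (L g : Module.End ℂ U) (c : ℂ) (f : UpperHalfPlane → ℂ) : Prop :=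
  Commute L g ∧ ∃ (β : Type) (b : Module.Basis β ℂ U) (w : β → ℚ),
    (∀ n, (w ⁻¹' {n}).Finite) ∧ (∀ i, L (b i) = (w i : ℂ) • b i) ∧
    ∀ τ : UpperHalfPlane, HasSum (fun i => b.repr (g (b i)) i *
      Complex.exp (2 * Real.pi * Complex.I * (τ : ℂ) * ((w i : ℂ) - c / 24))) (f τ)

theorem HasEigenbasisTrace.hasMcKayThompsonSeries {c : ℂ} {f : UpperHalfPlane → ℂ}
    (h : HasEigenbasisTrace L g c f) : HasMcKayThompsonSeries L g c f := by
  obtain ⟨hc, β, b, w, hw, hb, hf⟩ := h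
  exact hasMcKayThompsonSeries_of_basis b w hw hb hc c f hf

theorem HasEigenbasisTrace.prodMap {c : ℂ} {f : UpperHalfPlane → ℂ}
    (h : HasEigenbasisTrace L g c f) {U' : Type*} [AddCommGroup U'] [Module ℂ U']
    {L' g' : Module.End ℂ U'} {f' : UpperHalfPlane → ℂ} (h' : HasEigenbasisTrace L' g' c f') :
    HasEigenbasisTrace (LinearMap.prodMap L L') (LinearMap.prodMap g g') c
      (fun τ => f τ + f' τ) := by
  obtain ⟨hc, β, b, w, hw, hb, hf⟩ := h
  obtain ⟨hc', β', b', w', hw', hb', hf'⟩ := h'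
  refine ⟨?_, β ⊕ β', b.prod b', Sum.elim w w', fun n => ?_, ?_, fun τ => HasSum.sum ?_ ?_⟩
  · refine LinearMap.ext fun v => Prod.ext ?_ ?_
    · exact congrArg (fun f => f v.1) hc.eq
    · exact congrArg (fun f => f v.2) hc'.eq
  · exact Set.finite_preimage_inl_and_inr.1 ⟨hw n, hw' n⟩
  · rintro (i | i)
    · simp [hb]
    · simp [hb']
  · refine (hf τ).congr_fun' fun i => ?_
    simp
  · refine (hf' τ).congr_fun' fun i => ?_
    simp

/-- Traces are linear in the operator. The average is what computes a trace on the fixed space of an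
involution: it is applied to `x` and `𝔷x`. -/
theorem HasMcKayThompsonSeries.average {g' : Module.End ℂ U} {c : ℂ} {f f' : UpperHalfPlane → ℂ}
    (h : HasMcKayThompsonSeries L g c f) (h' : HasMcKayThompsonSeries L g' c f') :
    HasMcKayThompsonSeries L ((1 / 2 : ℂ) • (g + g')) c (fun τ => (1 / 2 : ℂ) * (f τ + f' τ)) := by
  obtain ⟨hi, hfd, hg, hs⟩ := h
  obtain ⟨-, -, hg', hs'⟩ := h'
  refine ⟨hi, hfd, fun n v hv => Submodule.smul_mem _ _
    (Submodule.add_mem _ (hg n v hv) (hg' n v hv)), fun τ => ?_⟩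
  refine (((hs τ).add (hs' τ)).mul_left (1 / 2 : ℂ)).congr_fun' fun n => ?_
  rw [← add_mul, ← map_add, ← mul_assoc]
  congr 1
  rw [← smul_eq_mul, ← map_smul]
  rfl

/-- Transport of a McKay-Thompson series to a retract. -/
theorem HasMcKayThompsonSeries.retract {c : ℂ} {f : UpperHalfPlane → ℂ}
    (h : HasMcKayThompsonSeries L g c f) {U' : Type*} [AddCommGroup U'] [Module ℂ U']
    {L' g' : Module.End ℂ U'} (j : U' →ₗ[ℂ] U) (P : U →ₗ[ℂ] U') (hPj : P ∘ₗ j = LinearMap.id)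
    (hj : L ∘ₗ j = j ∘ₗ L') (hP : P ∘ₗ L = L' ∘ₗ P) (hg : j ∘ₗ g' ∘ₗ P = g) :
    HasMcKayThompsonSeries L' g' c f := by
  obtain ⟨hi, hfd, hgn, hs⟩ := h
  have hPj' : ∀ v, P (j v) = v := fun v => congrArg (fun f => f v) hPj
  have hjn : ∀ n : ℚ, ∀ v ∈ L'.eigenspace (n : ℂ), j v ∈ L.eigenspace (n : ℂ) := by
    intro n v hv
    rw [Module.End.mem_eigenspace_iff] at hv ⊢
    rw [← LinearMap.comp_apply, hj, LinearMap.comp_apply, hv, map_smul]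
  have hPn : ∀ n : ℚ, ∀ v ∈ L.eigenspace (n : ℂ), P v ∈ L'.eigenspace (n : ℂ) := by
    intro n v hv
    rw [Module.End.mem_eigenspace_iff] at hv ⊢
    rw [← LinearMap.comp_apply, ← hP, LinearMap.comp_apply, hv, map_smul]
  have hg' : ∀ v, g' v = P (g (j v)) := by
    intro v
    rw [← hg]
    simp [hPj']
  have hgn' : ∀ n : ℚ, ∀ v ∈ L'.eigenspace (n : ℂ), g' v ∈ L'.eigenspace (n : ℂ) := by
    intro n v hv
    rw [hg']
    exact hPn _ _ (hgn _ _ (hjn _ _ hv))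
  refine ⟨isInternal_eigenspace_of_iSup_eq_top ?_, fun n => ?_, hgn', fun τ => ?_⟩
  · have ht := hi.submodule_iSup_eq_top
    have hs : LinearMap.range P = ⊤ := LinearMap.range_eq_top.2 fun v => ⟨j v, hPj' v⟩
    rw [eq_top_iff, ← hs, LinearMap.range_eq_map, ← ht, Submodule.map_iSup]
    refine iSup_mono fun n => ?_
    rintro _ ⟨v, hv, rfl⟩
    exact hPn n v hv
  · have := hfd n
    refine Module.Finite.of_injective (j.restrict (hjn n)) fun v w hvw => Subtype.ext ?_
    rw [← hPj' v, ← hPj' w]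
    exact congrArg (fun v => P v.1) hvw
  · refine (hs τ).congr_fun' fun n => ?_
    congr 1
    have := hfd n
    have h1 : FiniteDimensional ℂ (L'.eigenspace (n : ℂ)) := by
      refine Module.Finite.of_injective (j.restrict (hjn n)) fun v w hvw => Subtype.ext ?_
      rw [← hPj' v, ← hPj' w]
      exact congrArg (fun v => P v.1) hvw
    -- Inserting `P j = 1` and using cyclicity of the trace replaces `g'` by `j g' P = g` on each
    -- eigenspace.
    have h2 : g'.restrict (hgn' n) =
        (g'.restrict (hgn' n) ∘ₗ P.restrict (hPn n)) ∘ₗ j.restrict (hjn n) := by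
      ext v
      simp [hPj']
    rw [h2, LinearMap.trace_comp_comm']
    congr 1
    ext v
    change j (g' (P v)) = g v
    rw [← hg]; rfl

end McKay

end

end CliffordVOA

/-! ### The Fock space model of the cyclic Clifford modules -/

namespace CliffordVOA
noncomputable section
open scoped TensorProduct

/-- Contraction lowers the degree by one, hence is odd. This sign makes zero modes anticommute with
annihilation operators on the Fock space. -/
theorem involute_contractLeft {W : Type*} [AddCommGroup W] [Module ℂ W] {Q : QuadraticForm ℂ W}
    (d : Module.Dual ℂ W) (x : CliffordAlgebra Q) :
    involute (contractLeft d x) = -contractLeft d (involute x) := by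
  induction x using CliffordAlgebra.left_induction with
  | algebraMap r => simp
  | add x y hx hy => simp only [map_add, hx, hy]; abel
  | ι_mul x v hx =>
    simp only [contractLeft_ι_mul, map_sub, map_smul, map_mul, involute_ι, hx, neg_mul, map_neg,
      mul_neg]
    abel

namespace OrthoSpace

variable {V : Type*} [AddCommGroup V] [Module ℂ V] {N : ℕ} (u : OrthoSpace V N)

/-- The embedding of the space of creation operators: `single j v ↦ v ⊗ t^(-j - 1 + σ.shift / 2)`. -/
def creation : (ℕ →₀ V) →ₗ[ℂ] (ℤ →₀ V) := Finsupp.lmapDomain V ℂ fun j : ℕ => -(j : ℤ) - 1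

/-- The projection to the space of creation operators. -/
def creationPart : (ℤ →₀ V) →ₗ[ℂ] (ℕ →₀ V) :=
  Finsupp.lsum ℂ fun m : ℤ => if m < 0 then Finsupp.lsingle (-m - 1).toNat else 0

theorem creation_single (j : ℕ) (v : V) :
    creation (Finsupp.single j v) = Finsupp.single (-(j : ℤ) - 1) v := by
  simp [creation, Finsupp.mapDomain_single]

theorem creationPart_single (m : ℤ) (v : V) :
    creationPart (Finsupp.single m v) =
      if m < 0 then Finsupp.single (-m - 1).toNat v else 0 := by
  simp only [creationPart, Finsupp.lsum_single]
  split_ifs <;> rfl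

theorem creation_creationPart_single (m : ℤ) (v : V) :
    creation (creationPart (Finsupp.single m v)) = if m < 0 then Finsupp.single m v else 0 := by
  rw [creationPart_single]
  split_ifs with h
  · rw [creation_single]
    congr 1
    omega
  · simp

theorem creationPart_creation (x : ℕ →₀ V) : creationPart (creation x) = x := by
  have h : creationPart ∘ₗ creation = (LinearMap.id : (ℕ →₀ V) →ₗ[ℂ] _) := by
    refine Finsupp.lhom_ext fun j v => ?_
    rw [LinearMap.comp_apply, creation_single, creationPart_single, if_pos (by omega)]
    congr 1
    omega
  exact congrArg (fun f => f x) h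

/-- Two negative degrees never add up to zero. Isotropy makes the creation operators generate an
exterior algebra inside the Clifford algebra. -/
theorem hatForm_creation (σ : Sector) (x y : ℕ →₀ V) :
    u.hatForm σ (creation x) (creation y) = 0 := by
  have h : (u.hatForm σ).compl₁₂ creation creation = 0 := by
    ext i v j w
    simp only [LinearMap.comp_apply, Finsupp.lsingle_apply, LinearMap.compl₁₂_apply,
      creation_single, hatForm_single, Finsupp.single_apply]
    rw [if_neg (by cases σ <;> simp only [Sector.shift] <;> omega)]
    simp
  exact congrArg (fun f => f x y) h

/-- The zero mode of an element of `𝔲̂`, which vanishes in the untwisted sector. -/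
def zeroPart : Sector → (ℤ →₀ V) →ₗ[ℂ] V
  | .untwisted => 0
  | .twisted => Finsupp.lapply 0

theorem zeroPart_creation (σ : Sector) (x : ℕ →₀ V) : zeroPart σ (creation x) = 0 := by
  cases σ
  · rfl
  · have h : zeroPart Sector.twisted ∘ₗ creation = (0 : (ℕ →₀ V) →ₗ[ℂ] V) := by
      refine Finsupp.lhom_ext fun j v => ?_
      rw [LinearMap.comp_apply, creation_single]
      simp only [zeroPart, Finsupp.lapply_apply, LinearMap.zero_apply, Finsupp.single_apply]
      rw [if_neg (by omega)]
    exact congrArg (fun f => f x) h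

/-- Only opposite degrees pair: zero modes with zero modes, and positive modes with creation modes.
The latter pairing occurs twice by symmetry, and the creation part does not pair with itself or with
the zero modes. -/
theorem hatForm_self (σ : Sector) (y : ℤ →₀ V) :
    u.hatForm σ y y = u.form (zeroPart σ y) (zeroPart σ y) +
      2 * u.hatForm σ y (creation (creationPart y)) := by
  have h : u.hatForm σ = u.form.compl₁₂ (zeroPart σ) (zeroPart σ) +
      (u.hatForm σ).compl₂ (creation ∘ₗ creationPart) +
      (u.hatForm σ ∘ₗ (creation ∘ₗ creationPart)) := by
    ext m v n w
    simp only [LinearMap.comp_apply, Finsupp.lsingle_apply, LinearMap.compl₁₂_apply,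
      LinearMap.add_apply, LinearMap.compl₂_apply, creation_creationPart_single]
    have hc : ∀ (p : Prop) [Decidable p] (x : ℤ →₀ V),
        u.hatForm σ (if p then x else 0) = if p then u.hatForm σ x else 0 := fun p _ x => by
      split_ifs <;> simp
    have hc' : ∀ (p : Prop) [Decidable p] (x y : ℤ →₀ V),
        u.hatForm σ x (if p then y else 0) = if p then u.hatForm σ x y else 0 := fun p _ x y => by
      split_ifs <;> simp
    have hz : zeroPart σ (Finsupp.single m v) = if 2 * m + σ.shift = 0 then v else 0 := by
      cases σ
      · rw [if_neg (by simp only [Sector.shift]; omega)]; rfl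
      · simp [zeroPart, Sector.shift, Finsupp.single_apply]
    have hz' : zeroPart σ (Finsupp.single n w) = if 2 * n + σ.shift = 0 then w else 0 := by
      cases σ
      · rw [if_neg (by simp only [Sector.shift]; omega)]; rfl
      · simp [zeroPart, Sector.shift, Finsupp.single_apply]
    have hs : σ.shift = 0 ∨ σ.shift = 1 := by cases σ <;> simp [Sector.shift]
    rw [hc, hc', hz, hz', hatForm_single, Finsupp.single_apply]
    by_cases hmn : n = -m - σ.shift
    · rw [if_pos hmn]
      rcases lt_trichotomy (2 * m + σ.shift) 0 with h | h | h
      · rw [if_neg h.ne, if_neg (by omega : ¬ n < 0), if_pos (by omega : m < 0), hatForm_single,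
          Finsupp.single_apply, if_pos hmn]
        simp
      · rw [if_pos h, if_neg (by omega : ¬ n < 0), if_neg (by omega : ¬ m < 0), if_pos (by omega)]
        simp
      · rw [if_neg h.ne', if_neg (by omega : ¬ m < 0), if_pos (by omega : n < 0)]
        simp
    · rw [if_neg hmn]
      have h1 : u.hatForm σ (Finsupp.single m v) (Finsupp.single n w) = 0 := by
        rw [hatForm_single, Finsupp.single_apply, if_neg hmn, map_zero]
      by_cases h2 : 2 * m + σ.shift = 0
      · rw [if_neg (by omega : ¬ 2 * n + σ.shift = 0)]
        split_ifs <;> simp [h1]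
      · rw [if_neg h2]
        split_ifs <;> simp [h1]
  have h2 := congrArg (fun f => f y y) h
  simp only [LinearMap.comp_apply, LinearMap.compl₁₂_apply,
      LinearMap.add_apply, LinearMap.compl₂_apply] at h2
  rw [u.hatForm_symm σ (creation (creationPart y)) y] at h2
  linear_combination h2

/-- Operators on `M` by which the zero modes act. -/
structure ZeroModeAction (σ : Sector) (M : Type*) [AddCommGroup M] [Module ℂ M] where
  op : V →ₗ[ℂ] Module.End ℂ M
  op_op : ∀ y x, op (zeroPart σ y) (op (zeroPart σ y) x) =
    (-u.form (zeroPart σ y) (zeroPart σ y)) • x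

/-- The space of states `M ⊗ Λ(⊕_{r < 0} 𝔲 ⊗ t^r)` with ground states `M`. -/
abbrev Fock (V : Type*) [AddCommGroup V] [Module ℂ V] (M : Type*) [AddCommGroup M] [Module ℂ M] :
    Type _ := M ⊗[ℂ] ExteriorAlgebra ℂ (ℕ →₀ V)

/-- The functional `-2⟨y, ·⟩` on creation operators. -/
def pairing (σ : Sector) : (ℤ →₀ V) →ₗ[ℂ] Module.Dual ℂ (ℕ →₀ V) :=
  (-2 : ℂ) • (u.hatForm σ).compl₂ creation

theorem pairing_apply (σ : Sector) (y : ℤ →₀ V) (x : ℕ →₀ V) :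
    u.pairing σ y x = -2 * u.hatForm σ y (creation x) := rfl

namespace ZeroModeAction

variable {u} {σ : Sector} {M : Type*} [AddCommGroup M] [Module ℂ M] (Z : u.ZeroModeAction σ M)

/-- The operator on the Fock space attached to an element of `𝔲̂`. -/
def fockOp : (ℤ →₀ V) →ₗ[ℂ] Module.End ℂ (Fock V M) :=
  LinearMap.mulRight ℂ (LinearMap.lTensor M
      (involute : ExteriorAlgebra ℂ (ℕ →₀ V) →ₐ[ℂ] _).toLinearMap) ∘ₗ
    LinearMap.rTensorHom _ ∘ₗ Z.op ∘ₗ zeroPart σ +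
  LinearMap.lTensorHom M ∘ₗ
    (LinearMap.mul ℂ (ExteriorAlgebra ℂ (ℕ →₀ V)) ∘ₗ ExteriorAlgebra.ι ℂ ∘ₗ creationPart +
      contractLeft ∘ₗ u.pairing σ)

theorem fockOp_tmul (y : ℤ →₀ V) (x : M) (w : ExteriorAlgebra ℂ (ℕ →₀ V)) :
    Z.fockOp y (x ⊗ₜ w) = Z.op (zeroPart σ y) x ⊗ₜ involute w +
      x ⊗ₜ (ExteriorAlgebra.ι ℂ (creationPart y) * w + contractLeft (u.pairing σ y) w) := rfl

/-- Wedging and contracting each square to zero, and their anticommutator is the scalar `-2⟨y, y₋⟩`,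
where `y₋` is the creation part. The zero mode squares to `-⟨y₀, y₀⟩`, and its cross terms cancel
because `involute` anticommutes with wedging and contracting. By `hatForm_self` the total is `-⟨y,
y⟩`, the Clifford relation. -/
theorem fockOp_fockOp (y : ℤ →₀ V) (b : Fock V M) :
    Z.fockOp y (Z.fockOp y b) = u.hatQuad σ y • b := by
  induction b using TensorProduct.induction_on with
  | zero => simp
  | add a b ha hb => rw [map_add, map_add, ha, hb, smul_add]
  | tmul x w =>
    have h1 : ∀ v : ℕ →₀ V, ExteriorAlgebra.ι ℂ v * (ExteriorAlgebra.ι ℂ v * w) = 0 := by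
      intro v
      rw [← mul_assoc, ExteriorAlgebra.ι_sq_zero, zero_mul]
    have h2 : contractLeft (u.pairing σ y) (ExteriorAlgebra.ι ℂ (creationPart y) * w) =
        u.pairing σ y (creationPart y) • w -
          ExteriorAlgebra.ι ℂ (creationPart y) * contractLeft (u.pairing σ y) w :=
      contractLeft_ι_mul _ _ _
    have h3 : involute (ExteriorAlgebra.ι ℂ (creationPart y) * w) =
        -(ExteriorAlgebra.ι ℂ (creationPart y) * involute w) := by
      rw [map_mul, ← neg_mul]
      congr 1
      exact involute_ι _
    rw [fockOp_tmul, map_add, fockOp_tmul, fockOp_tmul, Z.op_op, involute_involute, map_add,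
      mul_add, h1, map_add, h2, contractLeft_contractLeft, h3, involute_contractLeft,
      pairing_apply, hatQuad_apply, hatForm_self]
    simp only [TensorProduct.tmul_add, TensorProduct.tmul_neg, ← TensorProduct.smul_tmul',
      TensorProduct.tmul_sub, TensorProduct.tmul_smul, TensorProduct.tmul_zero]
    module

/-- The action of the Clifford algebra on the Fock space. -/
def rho : u.HatCliff σ →ₐ[ℂ] Module.End ℂ (Fock V M) :=
  CliffordAlgebra.lift _ ⟨Z.fockOp, fun y => LinearMap.ext fun b => Z.fockOp_fockOp y b⟩

theorem rho_ι (y : ℤ →₀ V) : Z.rho (ι _ y) = Z.fockOp y := CliffordAlgebra.lift_ι_apply _ _ _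

end ZeroModeAction

/-- The isotropic embedding of the exterior algebra of the creation operators. -/
def creationAlg (σ : Sector) : ExteriorAlgebra ℂ (ℕ →₀ V) →ₐ[ℂ] u.HatCliff σ :=
  ExteriorAlgebra.lift ℂ ⟨ι _ ∘ₗ creation, fun x => by
    rw [LinearMap.comp_apply, ι_sq_scalar, hatQuad_apply, hatForm_creation, neg_zero, map_zero]⟩

theorem creationAlg_ι (σ : Sector) (x : ℕ →₀ V) :
    u.creationAlg σ (ExteriorAlgebra.ι ℂ x) = ι _ (creation x) :=
  ExteriorAlgebra.lift_ι_apply _ _ _ _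

/-- A creation operator has no zero mode, and its contraction vanishes by isotropy, so only wedging
survives. -/
theorem rho_creationAlg {σ : Sector} {M : Type*} [AddCommGroup M] [Module ℂ M]
    (Z : u.ZeroModeAction σ M) (w : ExteriorAlgebra ℂ (ℕ →₀ V)) (x : M)
    (w' : ExteriorAlgebra ℂ (ℕ →₀ V)) :
    Z.rho (u.creationAlg σ w) (x ⊗ₜ w') = x ⊗ₜ (w * w') := by
  induction w using ExteriorAlgebra.induction generalizing w' with
  | algebraMap r => simp [Algebra.smul_def, Module.algebraMap_end_apply, ← TensorProduct.tmul_smul]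
  | ι v =>
    have h : u.pairing σ (creation v) = 0 := by
      refine LinearMap.ext fun x => ?_
      rw [pairing_apply, hatForm_creation, mul_zero, LinearMap.zero_apply]
    rw [creationAlg_ι, Z.rho_ι, Z.fockOp_tmul, zeroPart_creation, creationPart_creation, h]
    simp
  | mul a b ha hb => rw [map_mul, map_mul, Module.End.mul_apply, hb, ha, mul_assoc]
  | add a b ha hb => rw [map_add, map_add, LinearMap.add_apply, ha, hb, add_mul,
      TensorProduct.tmul_add]

/-- Ground states of the module `Cliff(𝔲̂) ⧸ J`: the space `M` embeds in the module, contains the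
vacuum vector, is killed by the annihilation operators and stable under zero modes. -/
structure GroundStates {σ : Sector} (J : Submodule (u.HatCliff σ) (u.HatCliff σ)) {M : Type*}
    [AddCommGroup M] [Module ℂ M] (Z : u.ZeroModeAction σ M) where
  emb : M →ₗ[ℂ] CyclicModule J
  vac : M
  emb_vac : emb vac = CyclicModule.mk J 1
  smul_emb : ∀ y x, ι (u.hatQuad σ) y • emb x =
    emb (Z.op (zeroPart σ y) x) + ι (u.hatQuad σ) (creation (creationPart y)) • emb x
  rho_eq_zero : ∀ a ∈ J, Z.rho a (vac ⊗ₜ 1) = 0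
  exists_rho_eq : ∀ x, ∃ a, emb x = CyclicModule.mk J a ∧ Z.rho a (vac ⊗ₜ 1) = x ⊗ₜ 1

namespace GroundStates

variable {u} {σ : Sector} {J : Submodule (u.HatCliff σ) (u.HatCliff σ)} {M : Type*}
  [AddCommGroup M] [Module ℂ M] {Z : u.ZeroModeAction σ M} (G : u.GroundStates J Z)

/-- The map from the Fock space to `Cliff(𝔲̂) ⧸ J`. -/
def fromFock : Fock V M →ₗ[ℂ] CyclicModule J :=
  TensorProduct.lift (LinearMap.flip
    ((Algebra.lsmul ℂ ℂ (CyclicModule J)).toLinearMap ∘ₗ (u.creationAlg σ).toLinearMap) ∘ₗ G.emb)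

theorem fromFock_tmul (x : M) (w : ExteriorAlgebra ℂ (ℕ →₀ V)) :
    G.fromFock (x ⊗ₜ w) = u.creationAlg σ w • G.emb x := rfl

/-- By induction on products in the exterior algebra, `y` is moved to the right past the creation
operators. Each swap costs a sign and the scalar `-2⟨y, ·⟩`, exactly as in the Leibniz rule for
contraction; once `y` reaches the ground state, `smul_emb` applies. -/
theorem fromFock_fockOp (y : ℤ →₀ V) (b : Fock V M) :
    G.fromFock (Z.fockOp y b) = ι (u.hatQuad σ) y • G.fromFock b := by
  induction b using TensorProduct.induction_on with
  | zero => simp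
  | add a b ha hb => rw [map_add, map_add, map_add, ha, hb, smul_add]
  | tmul x w =>
    rw [Z.fockOp_tmul, map_add, fromFock_tmul, fromFock_tmul, fromFock_tmul]
    induction w using CliffordAlgebra.left_induction with
    | algebraMap r =>
      rw [involute.commutes, contractLeft_algebraMap, add_zero, map_mul, creationAlg_ι,
        AlgHom.commutes, mul_smul, ← mul_smul (ι _ y), ← Algebra.commutes r (ι _ y), mul_smul,
        G.smul_emb, smul_add, ← mul_smul, ← mul_smul, Algebra.commutes]
    | add a b ha hb =>
      simp only [map_add, mul_add, add_smul, smul_add] at ha hb ⊢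
      rw [← ha, ← hb]
      abel
    | ι_mul w v hw =>
      have h1 : u.creationAlg σ (involute (ι (0 : QuadraticForm ℂ (ℕ →₀ V)) v * w)) =
          -(ι _ (creation v) * u.creationAlg σ (involute w)) := by
        rw [map_mul, involute_ι, neg_mul, map_neg, map_mul]
        congr 2
        exact u.creationAlg_ι σ v
      have h3 : ExteriorAlgebra.ι ℂ (creationPart y) * (ι (0 : QuadraticForm ℂ (ℕ →₀ V)) v * w) =
          -(ι (0 : QuadraticForm ℂ (ℕ →₀ V)) v * (ExteriorAlgebra.ι ℂ (creationPart y) * w)) := by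
        have := ExteriorAlgebra.ι_add_mul_swap (R := ℂ) (creationPart y) v
        rw [← mul_assoc, ← mul_assoc, ← neg_mul]
        congr 1
        exact eq_neg_of_add_eq_zero_left this
      have h4 : ∀ w, u.creationAlg σ (ι (0 : QuadraticForm ℂ (ℕ →₀ V)) v * w) =
          ι _ (creation v) * u.creationAlg σ w := fun w => by
        rw [map_mul]
        congr 1
        exact u.creationAlg_ι σ v
      rw [h1, h3, contractLeft_ι_mul, map_add, map_neg, map_sub, h4, h4, h4, ← mul_smul, ← mul_assoc,
        ι_mul_ι_swap, map_smul, pairing_apply]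
      rw [map_add] at hw
      simp only [add_smul, neg_smul, mul_smul, sub_smul, neg_mul, add_mul, mul_assoc, ← hw,
        smul_add, Algebra.algebraMap_eq_smul_one, smul_mul_assoc, one_mul, smul_assoc]
      abel

theorem fromFock_rho (a : u.HatCliff σ) (b : Fock V M) :
    G.fromFock (Z.rho a b) = a • G.fromFock b := by
  induction a using CliffordAlgebra.induction generalizing b with
  | algebraMap r => simp [Module.algebraMap_end_apply]
  | ι y => rw [Z.rho_ι, fromFock_fockOp]
  | mul a a' ha ha' => rw [map_mul, Module.End.mul_apply, ha, ha', mul_smul]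
  | add a a' ha ha' => rw [map_add, LinearMap.add_apply, map_add, ha, ha', add_smul]

/-- The map from `Cliff(𝔲̂) ⧸ J` to the Fock space. -/
def toFock : CyclicModule J →ₗ[ℂ] Fock V M :=
  (J.restrictScalars ℂ).liftQ (Z.rho.toLinearMap.flip (G.vac ⊗ₜ 1)) fun a ha =>
    G.rho_eq_zero a ha

theorem toFock_mk (a : u.HatCliff σ) :
    G.toFock (CyclicModule.mk J a) = Z.rho a (G.vac ⊗ₜ 1) := rfl

theorem toFock_smul (a : u.HatCliff σ) (b : CyclicModule J) :
    G.toFock (a • b) = Z.rho a (G.toFock b) := by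
  obtain ⟨c, rfl⟩ := CyclicModule.mk_surjective J b
  rw [← map_smul, toFock_mk, toFock_mk, smul_eq_mul, map_mul, Module.End.mul_apply]

/-- The module `Cliff(𝔲̂) ⧸ J` is isomorphic to the Fock space. -/
def fockEquiv : Fock V M ≃ₗ[ℂ] CyclicModule J :=
  LinearEquiv.ofLinearMap G.fromFock G.toFock
    (by
      ext b
      obtain ⟨a, rfl⟩ := CyclicModule.mk_surjective J b
      rw [LinearMap.comp_apply, toFock_mk, fromFock_rho, fromFock_tmul, map_one, one_smul,
        G.emb_vac, ← map_smul, smul_eq_mul, mul_one, LinearMap.id_apply])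
    (by
      refine TensorProduct.ext' fun x w => ?_
      -- The same `a` produces the ground state `x` from the vacuum in both modules, so `toFock`
      -- sends `emb x` to `x ⊗ 1`; the creation operators then restore `w`.
      obtain ⟨a, ha, hax⟩ := G.exists_rho_eq x
      rw [LinearMap.comp_apply, fromFock_tmul, toFock_smul, ha, toFock_mk, hax, rho_creationAlg,
        mul_one, LinearMap.id_apply])

theorem fockEquiv_tmul (x : M) (w : ExteriorAlgebra ℂ (ℕ →₀ V)) :
    G.fockEquiv (x ⊗ₜ w) = u.creationAlg σ w • G.emb x := rfl

end GroundStates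

end OrthoSpace

end

end CliffordVOA

/-! ### The operator `L(0)` and its commutators with modes -/

namespace CliffordVOA
noncomputable section
open scoped TensorProduct

namespace OrthoSpace

variable {V : Type*} [AddCommGroup V] [Module ℂ V] {N : ℕ} (u : OrthoSpace V N)

theorem sum_form_basis (v : V) : ∑ i, u.form (u.basis i) v • u.basis i = v := by
  have h : ∑ i, (u.form (u.basis i)).smulRight (u.basis i) = LinearMap.id :=
    u.basis.ext fun j => by
      simp [LinearMap.sum_apply, u.orthonormal]
  have h2 := congrArg (fun f => f v) h
  simpa [LinearMap.sum_apply] using h2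

/-- The lowest eigenvalue of `L(0)`. -/
def groundWeight (N : ℕ) : Sector → ℚ
  | .untwisted => 0
  | .twisted => N / 8

/-- The degree operator on `𝔲̂`. -/
def degree (σ : Sector) : (ℤ →₀ V) →ₗ[ℂ] (ℤ →₀ V) :=
  Finsupp.lsum ℂ fun m : ℤ => ((m : ℂ) + σ.shift / 2) • Finsupp.lsingle m

theorem degree_single (σ : Sector) (m : ℤ) (v : V) :
    degree σ (Finsupp.single m v) = ((m : ℂ) + σ.shift / 2) • Finsupp.single m v := by
  simp only [degree, Finsupp.lsum_single]
  rfl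

variable {u}
variable {σ : Sector} {J : Submodule (u.HatCliff σ) (u.HatCliff σ)} (hJ : u.positiveIdeal σ ≤ J)

/-- Moving `v(p)` through a product of two modes uses two anticommutators, each a scalar supported
on one value of `m`. The normal ordering only reorders the factors with the matching sign, which
gives the same commutator. -/
theorem normalOrder_mul_mode (e v : V) (m p : ℤ) :
    u.normalOrder σ e e m (-σ.shift - m) * u.mode σ v p =
      u.mode σ v p * u.normalOrder σ e e m (-σ.shift - m) +
        (if m = p then -2 * u.form e v else 0) • u.mode σ e p -
        (if m = -σ.shift - p then -2 * u.form e v else 0) • u.mode σ e p := by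
  have hsw : ∀ a : ℤ, u.mode σ e a * u.mode σ v p = -(u.mode σ v p * u.mode σ e a) +
      algebraMap ℂ _ (if a = -σ.shift - p then -2 * u.form e v else 0) := by
    intro a
    rw [mode, mode, ι_mul_ι_swap, hatForm_single, Finsupp.single_apply]
    congr 2
    by_cases h : a = -σ.shift - p
    · rw [if_pos h, if_pos (by omega)]
    · rw [if_neg h, if_neg (by omega), map_zero, mul_zero]
  have key : ∀ a b : ℤ, u.mode σ e a * u.mode σ e b * u.mode σ v p =
      u.mode σ v p * (u.mode σ e a * u.mode σ e b) +
        (if b = -σ.shift - p then -2 * u.form e v else 0) • u.mode σ e a -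
        (if a = -σ.shift - p then -2 * u.form e v else 0) • u.mode σ e b := by
    intro a b
    rw [mul_assoc, hsw, mul_add, mul_neg, ← mul_assoc, hsw, add_mul, ← Algebra.commutes,
      ← Algebra.smul_def, ← Algebra.smul_def, neg_mul, mul_assoc]
    abel
  have h1 : (if -σ.shift - m = -σ.shift - p then -2 * u.form e v else 0) • u.mode σ e m =
      (if m = p then -2 * u.form e v else 0) • u.mode σ e p := by
    by_cases h : m = p
    · rw [if_pos h, if_pos (by omega), h]
    · rw [if_neg h, if_neg (by omega), zero_smul, zero_smul]
  have h2 : (if m = -σ.shift - p then -2 * u.form e v else 0) • u.mode σ e (-σ.shift - m) =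
      (if m = -σ.shift - p then -2 * u.form e v else 0) • u.mode σ e p := by
    by_cases h : m = -σ.shift - p
    · rw [if_pos h, show -σ.shift - m = p by omega]
    · rw [if_neg h, zero_smul, zero_smul]
  unfold normalOrder
  by_cases h3 : m < -σ.shift - m
  · rw [if_pos h3, key, h1, h2]
  by_cases h4 : -σ.shift - m < m
  · rw [if_neg h3, if_pos h4, neg_mul, key, h1, h2, mul_neg]
    abel
  · have h5 : 2 * m + σ.shift = 0 := by omega
    rw [if_neg h3, if_neg h4, if_pos h5, show -σ.shift - m = m by omega, sub_self, smul_zero,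
      zero_mul, mul_zero, zero_add]
    by_cases h6 : m = p
    · rw [if_pos h6, if_pos (by omega), sub_self]
    · rw [if_neg h6, if_neg (by omega), sub_self]

/-- The commutator is a sum over `m` of which only `m = p` and `m = -σ.shift - p` survive. This
reduces an infinite sum of operators to two scalar multiples of `e(p)`. -/
theorem quadraticField_mode_smul (e v : V) (p : ℤ) (b : CyclicModule J) :
    u.quadraticField hJ e 0 (u.mode σ v p • b) =
      u.mode σ v p • u.quadraticField hJ e 0 b -
        ((2 * (p : ℂ) + σ.shift) * (2 * u.form e v)) • u.mode σ e p • b := by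
  change ∑ᶠ m : ℤ, ((m : ℂ) + σ.shift / 2 - (0 : ℤ) - 1 / 2) •
      u.normalOrder σ e e m (0 - σ.shift - m) • u.mode σ v p • b =
    u.mode σ v p • ∑ᶠ m : ℤ, ((m : ℂ) + σ.shift / 2 - (0 : ℤ) - 1 / 2) •
      u.normalOrder σ e e m (0 - σ.shift - m) • b - _
  simp only [Int.cast_zero, sub_zero, zero_sub]
  have hfin := u.finite_support_normalOrder hJ e (-σ.shift)
    (fun m : ℤ => (m : ℂ) + σ.shift / 2 - 1 / 2) b
  rw [smul_finsum' _ hfin]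
  have hterm : ∀ m : ℤ, ((m : ℂ) + σ.shift / 2 - 1 / 2) •
      u.normalOrder σ e e m (-σ.shift - m) • u.mode σ v p • b =
      u.mode σ v p • (((m : ℂ) + σ.shift / 2 - 1 / 2) •
        u.normalOrder σ e e m (-σ.shift - m) • b) +
      ((if m = p then ((m : ℂ) + σ.shift / 2 - 1 / 2) * (-2 * u.form e v) else 0) •
        u.mode σ e p • b +
      (if m = -σ.shift - p then -((m : ℂ) + σ.shift / 2 - 1 / 2) * (-2 * u.form e v) else 0) •
        u.mode σ e p • b) := by
    intro m
    rw [← mul_smul (u.normalOrder _ _ _ _ _), normalOrder_mul_mode, sub_smul _ _ b,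
      add_smul _ _ b, mul_smul (u.mode σ v p), smul_assoc, smul_assoc,
      smul_comm (u.mode σ v p) ((m : ℂ) + σ.shift / 2 - 1 / 2)]
    generalize u.mode σ v p • u.normalOrder σ e e m (-σ.shift - m) • b = X
    generalize u.mode σ e p • b = Y
    split_ifs <;> module
  have hs1 : (Function.support fun m : ℤ => (if m = p then
      ((m : ℂ) + σ.shift / 2 - 1 / 2) * (-2 * u.form e v) else 0) •
        u.mode σ e p • b).Finite := by
    refine (Set.finite_singleton p).subset fun m hm => ?_
    by_contra h
    exact hm (by simp only; rw [if_neg (Set.mem_singleton_iff.not.1 h), zero_smul])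
  have hs2 : (Function.support fun m : ℤ => (if m = -σ.shift - p then
      -((m : ℂ) + σ.shift / 2 - 1 / 2) * (-2 * u.form e v) else 0) •
        u.mode σ e p • b).Finite := by
    refine (Set.finite_singleton (-σ.shift - p)).subset fun m hm => ?_
    by_contra h
    exact hm (by simp only; rw [if_neg (Set.mem_singleton_iff.not.1 h), zero_smul])
  rw [finsum_congr hterm, finsum_add_distrib (hfin.subset ?_) ?_, finsum_add_distrib hs1 hs2,
    finsum_eq_single (fun m : ℤ => (if m = p then _ else (0 : ℂ)) • u.mode σ e p • b) p,
    finsum_eq_single (fun m : ℤ => (if m = -σ.shift - p then _ else (0 : ℂ)) • u.mode σ e p • b)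
      (-σ.shift - p), if_pos rfl, if_pos rfl, ← add_smul, eq_sub_iff_add_eq,
    add_assoc, ← add_smul]
  -- With `r = p + σ.shift / 2`, the two surviving terms carry `r - 1/2` and `r + 1/2`: the halves
  -- coming from `∂_z` cancel and leave `2r`.
  · convert add_zero _ using 2
    convert zero_smul ℂ _ using 2
    push_cast
    ring
  · intro m hm
    rw [if_neg hm, zero_smul]
  · intro m hm
    rw [if_neg hm, zero_smul]
  · intro m hm h
    exact hm (by simp only at h ⊢; rw [h, smul_zero])
  · exact (hs1.union hs2).subset (Function.support_add _ _)

/-- Expanding `v` in the orthonormal basis collects the terms `⟨e_i, v⟩ e_i(r)` into `v(r)`, and the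
constants combine as `(1/4) · 2r · 2 = r`. Thus `[L(0), v(r)] = -r v(r)`. -/
theorem virasoro_mode_smul (v : V) (p : ℤ) (b : CyclicModule J) :
    u.virasoro hJ 0 (u.mode σ v p • b) =
      u.mode σ v p • u.virasoro hJ 0 b - ((p : ℂ) + σ.shift / 2) • u.mode σ v p • b := by
  have hv : u.mode σ v p • b = ∑ i, u.form (u.basis i) v • u.mode σ (u.basis i) p • b := by
    conv_lhs => rw [← u.sum_form_basis v]
    simp only [mode, ← Finsupp.lsingle_apply (R := ℂ), map_sum, map_smul, Finset.sum_smul,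
      smul_assoc]
  simp only [virasoro, LinearMap.smul_apply, LinearMap.sum_apply, LinearMap.add_apply,
    Module.End.one_apply, quadraticField_mode_smul]
  rw [smul_comm (u.mode σ v p), Finset.smul_sum (s := Finset.univ) (r := u.mode σ v p)]
  conv_rhs => rw [hv]
  rw [Finset.smul_sum, Finset.smul_sum, Finset.smul_sum, ← Finset.sum_sub_distrib]
  refine Finset.sum_congr rfl fun i _ => ?_
  rw [smul_add (u.mode σ v p), smul_comm (u.mode σ v p) (twistCorrection σ 0)]
  generalize u.mode σ v p • (u.quadraticField hJ (u.basis i) 0) b = X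
  generalize u.mode σ v p • b = Y
  generalize u.mode σ (u.basis i) p • b = Z
  module

theorem virasoro_ι_smul (y : ℤ →₀ V) (b : CyclicModule J) :
    u.virasoro hJ 0 (ι (u.hatQuad σ) y • b) =
      ι (u.hatQuad σ) y • u.virasoro hJ 0 b - ι (u.hatQuad σ) (degree σ y) • b := by
  induction y using Finsupp.induction_linear with
  | zero => simp
  | add x y hx hy =>
    simp only [map_add, add_smul, hx, hy]
    abel
  | single m v =>
    rw [degree_single, map_smul (ι (u.hatQuad σ)), smul_assoc]
    exact virasoro_mode_smul hJ v m b

/-- A normally ordered product of total degree zero has an annihilating mode on the right, or else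
is the antisymmetrized square of a zero mode, which is zero. Only the correction term is left; in
the twisted sector it gives `(1/4) · 2N · (1/4) = N/8`. -/
theorem virasoro_mk_one : u.virasoro hJ 0 (CyclicModule.mk J 1) =
    (groundWeight N σ : ℂ) • CyclicModule.mk J 1 := by
  have hk : ∀ (v : V) (m : ℤ), 0 < 2 * m + σ.shift → u.mode σ v m • CyclicModule.mk J 1 = 0 := by
    intro v m hm
    rw [← map_smul, CyclicModule.mk_eq_zero, smul_eq_mul, mul_one]
    exact hJ (Submodule.subset_span ⟨v, m, hm, rfl⟩)
  have hq : ∀ v, u.quadraticField hJ v 0 (CyclicModule.mk J 1) = 0 := by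
    intro v
    change ∑ᶠ m : ℤ, ((m : ℂ) + σ.shift / 2 - (0 : ℤ) - 1 / 2) •
      u.normalOrder σ v v m (0 - σ.shift - m) • CyclicModule.mk J 1 = 0
    refine finsum_eq_zero_of_forall_eq_zero fun m => ?_
    have : u.normalOrder σ v v m (0 - σ.shift - m) • CyclicModule.mk J 1 = 0 := by
      unfold normalOrder
      split_ifs with h1 h2 h3
      · rw [mul_smul, hk _ _ (by omega), smul_zero]
      · rw [neg_smul, mul_smul, hk _ _ (by omega), smul_zero, neg_zero]
      · rw [show 0 - σ.shift - m = m by omega, sub_self, smul_zero, zero_smul]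
      -- Two equal indices of total degree zero are zero modes, so the last branch of `normalOrder`
      -- cannot occur.
      · omega
    rw [this, smul_zero]
  simp only [virasoro, LinearMap.smul_apply, LinearMap.sum_apply, LinearMap.add_apply,
    Module.End.one_apply, hq, zero_add, Finset.sum_const, Finset.card_univ, Fintype.card_fin]
  rw [← Nat.cast_smul_eq_nsmul ℂ, smul_smul, smul_smul]
  congr 1
  cases σ
  · simp [groundWeight, twistCorrection]
  · simp only [groundWeight, twistCorrection]
    push_cast
    ring

/-- A map commuting with `L(0)` on the vacuum vector and intertwining the modes up to an operator
on `𝔲` commutes with `L(0)`. -/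
theorem commute_virasoro {g : Module.End ℂ (CyclicModule J)} (h : V →ₗ[ℂ] V)
    (hg : ∀ (y : ℤ →₀ V) b, g (ι (u.hatQuad σ) y • b) =
      ι (u.hatQuad σ) (Finsupp.mapRange.linearMap h y) • g b)
    (hvac : u.virasoro hJ 0 (g (CyclicModule.mk J 1)) =
      (groundWeight N σ : ℂ) • g (CyclicModule.mk J 1)) :
    Commute (u.virasoro hJ 0) g := by
  have hd : ∀ y, degree σ (Finsupp.mapRange.linearMap h y) =
      Finsupp.mapRange.linearMap h (degree σ y) := by
    intro y
    have : degree σ ∘ₗ Finsupp.mapRange.linearMap h =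
        Finsupp.mapRange.linearMap h ∘ₗ degree σ := by
      refine Finsupp.lhom_ext fun m v => ?_
      simp only [LinearMap.comp_apply, Finsupp.mapRange.linearMap_apply, Finsupp.mapRange_single,
        degree_single]
      simp
    exact congrArg (fun f => f y) this
  refine LinearMap.ext fun b => ?_
  obtain ⟨a, rfl⟩ := CyclicModule.mk_surjective J b
  rw [Module.End.mul_apply, Module.End.mul_apply]
  induction a using CliffordAlgebra.left_induction with
  | algebraMap r =>
    rw [Algebra.algebraMap_eq_smul_one, ← LinearMap.restrictScalars_apply ℂ (CyclicModule.mk J),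
      map_smul, LinearMap.restrictScalars_apply]
    simp only [map_smul, hvac, virasoro_mk_one]
  | add a b ha hb => simp only [map_add, ha, hb]
  | ι_mul a y ha =>
    rw [← smul_eq_mul, map_smul, hg, virasoro_ι_smul, ha, virasoro_ι_smul, map_sub, hg, hg, hd]

end OrthoSpace

end

end CliffordVOA

/-! ### Ground states of the two sectors and the spin action on them -/

namespace CliffordVOA
noncomputable section
open scoped TensorProduct

theorem CyclicModule.mk_algebraMap {C : Type*} [Ring C] [Algebra ℂ C] (J : Submodule C C) (r : ℂ) :
    CyclicModule.mk J (algebraMap ℂ C r) = r • CyclicModule.mk J 1 := by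
  rw [← algebraMap_smul C r, ← map_smul, smul_eq_mul, mul_one]

namespace OrthoSpace

variable {V : Type*} [AddCommGroup V] [Module ℂ V] {N : ℕ} (u : OrthoSpace V N)

/-- The part of an element of `𝔲̂` in positive degrees acts by zero on a ground state. -/
theorem ι_smul_of_positive {σ : Sector} {J : Submodule (u.HatCliff σ) (u.HatCliff σ)}
    {b : CyclicModule J} (hb : ∀ (v : V) (m : ℤ), 0 < 2 * m + σ.shift → u.mode σ v m • b = 0)
    (y : ℤ →₀ V) : ι (u.hatQuad σ) y • b = u.mode σ (zeroPart σ y) 0 • b +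
      ι (u.hatQuad σ) (creation (creationPart y)) • b := by
  induction y using Finsupp.induction_linear with
  | zero => simp [mode]
  | add x y hx hy =>
    simp only [mode, map_add, Finsupp.single_add, add_smul] at hx hy ⊢
    rw [hx, hy]
    abel
  | single m v =>
    rw [creation_creationPart_single]
    cases σ
    · rw [show zeroPart Sector.untwisted (Finsupp.single m v) = 0 from rfl]
      split_ifs with h
      · simp [mode]
      · have := hb v m (by simp only [Sector.shift]; omega)
        rw [mode] at this
        simp [mode, this]
    · rw [show zeroPart Sector.twisted (Finsupp.single m v) = Finsupp.single m v 0 from rfl]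
      rcases lt_trichotomy m 0 with h | h | h
      · rw [if_pos h, Finsupp.single_eq_of_ne h.ne']
        simp [mode]
      · subst h
        simp [mode]
      · have := hb v m (by simp only [Sector.shift]; omega)
        rw [mode] at this
        rw [if_neg (by omega), Finsupp.single_eq_of_ne h.ne]
        simp [mode, this]

theorem mk_one_positive {σ : Sector} {J : Submodule (u.HatCliff σ) (u.HatCliff σ)}
    (hJ : u.positiveIdeal σ ≤ J) (v : V) (m : ℤ) (hm : 0 < 2 * m + σ.shift) :
    u.mode σ v m • CyclicModule.mk J 1 = 0 := by
  rw [← map_smul, CyclicModule.mk_eq_zero, smul_eq_mul, mul_one]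
  exact hJ (Submodule.subset_span ⟨v, m, hm, rfl⟩)

/-- A positive mode has neither zero part nor creation part, and its contraction kills the unit of
the exterior algebra. -/
theorem rho_positiveIdeal {σ : Sector} {M : Type*} [AddCommGroup M] [Module ℂ M]
    (Z : u.ZeroModeAction σ M) (x : M) {a : u.HatCliff σ} (ha : a ∈ u.positiveIdeal σ) :
    Z.rho a (x ⊗ₜ 1) = 0 := by
  induction ha using Submodule.span_induction with
  | mem a h =>
    obtain ⟨v, m, hm, rfl⟩ := h
    have h0 : zeroPart σ (Finsupp.single m v) = 0 := by
      cases σ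
      · rfl
      · exact Finsupp.single_eq_of_ne (by simp only [Sector.shift] at hm; omega)
    have h1 : ¬ m < 0 := by cases σ <;> simp only [Sector.shift] at hm <;> omega
    rw [mode, Z.rho_ι, Z.fockOp_tmul, h0, creationPart_single, if_neg h1, map_zero, map_zero,
      contractLeft_one]
    simp
  | zero => rw [map_zero, LinearMap.zero_apply]
  | add a b _ _ ha hb => rw [map_add, LinearMap.add_apply, ha, hb, add_zero]
  | smul c a _ ha => rw [smul_eq_mul, map_mul, Module.End.mul_apply, ha, map_zero]

/-! ### Ground states of the untwisted module -/

/-- The trivial zero-mode action of the untwisted sector. -/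
def untwistedZero : u.ZeroModeAction .untwisted ℂ where
  op := 0
  op_op y x := by simp [zeroPart]

/-- The vacuum line of `A(𝔲)`. -/
def untwistedGround : u.GroundStates (u.positiveIdeal .untwisted) u.untwistedZero where
  emb := LinearMap.toSpanSingleton ℂ _ (CyclicModule.mk _ 1)
  vac := 1
  emb_vac := one_smul _ _
  smul_emb y x := by
    rw [u.ι_smul_of_positive fun v m hm => by
      rw [LinearMap.toSpanSingleton_apply, smul_comm, u.mk_one_positive le_rfl v m hm, smul_zero]]
    simp [zeroPart, mode, untwistedZero]
  rho_eq_zero a ha := u.rho_positiveIdeal _ _ ha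
  exists_rho_eq x := ⟨algebraMap ℂ _ x, by
    rw [LinearMap.toSpanSingleton_apply, CyclicModule.mk_algebraMap], by
    rw [AlgHom.commutes, Module.algebraMap_end_apply, TensorProduct.smul_tmul', smul_eq_mul,
      mul_one]⟩

/-! ### Ground states of the twisted module -/

variable {u}
variable (E : u.HomogeneousLift)

/-- The zero-mode action on the Clifford module `CM(𝔲)_E`. -/
def twistedZero : u.ZeroModeAction .twisted (CM E) where
  op := (Algebra.lsmul ℂ ℂ (CM E)).toLinearMap ∘ₗ ι u.quad
  op_op y x := by
    change ι u.quad _ • ι u.quad _ • x = _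
    rw [← mul_smul, ι_sq_scalar, algebraMap_smul, quad_apply]

theorem positiveIdeal_le_twistedIdeal : u.positiveIdeal .twisted ≤ twistedIdeal E := le_sup_left

theorem rho_zeroEmb (c : u.Cliff) (x : CM E) :
    (twistedZero E).rho (u.zeroEmb c) (x ⊗ₜ 1) = (c • x) ⊗ₜ 1 := by
  induction c using CliffordAlgebra.induction generalizing x with
  | algebraMap r =>
    rw [AlgHom.commutes, AlgHom.commutes, Module.algebraMap_end_apply, algebraMap_smul,
      TensorProduct.smul_tmul']
  | ι v =>
    rw [zeroEmb_ι, mode, ZeroModeAction.rho_ι, ZeroModeAction.fockOp_tmul, creationPart_single,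
      if_neg (lt_irrefl 0), map_zero, zero_mul, contractLeft_one, add_zero, TensorProduct.tmul_zero,
      add_zero, map_one, show zeroPart Sector.twisted (Finsupp.single 0 v) = v from
        Finsupp.single_eq_same]
    rfl
  | mul a b ha hb => rw [map_mul, map_mul, Module.End.mul_apply, hb, ha, mul_smul]
  | add a b ha hb => rw [map_add, map_add, LinearMap.add_apply, ha, hb, add_smul,
      TensorProduct.add_tmul]

theorem zeroEmb_mem_twistedIdeal {c : u.Cliff}
    (hc : c ∈ Submodule.span u.Cliff {a | ∃ g ∈ E.group, a = (g : u.Cliff) - 1}) :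
    u.zeroEmb c ∈ twistedIdeal E := by
  induction hc using Submodule.span_induction with
  | mem a h =>
    obtain ⟨g, hg, rfl⟩ := h
    rw [map_sub, map_one]
    exact Submodule.mem_sup_right (Submodule.subset_span ⟨g, hg, rfl⟩)
  | zero => rw [map_zero]; exact Submodule.zero_mem _
  | add a b _ _ ha hb => rw [map_add]; exact Submodule.add_mem _ ha hb
  | smul c a _ ha => rw [smul_eq_mul, map_mul]; exact Submodule.smul_mem _ _ ha

/-- The embedding of `CM(𝔲)_E` as the space of ground states of `A(𝔲)_{θ,E}`. -/
def twistedEmb : CM E →ₗ[ℂ] Atw E :=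
  Submodule.liftQ (Submodule.restrictScalars ℂ
      (Submodule.span u.Cliff {a | ∃ g ∈ E.group, a = (g : u.Cliff) - 1}))
    ((CyclicModule.mk (twistedIdeal E)).restrictScalars ℂ ∘ₗ u.zeroEmb.toLinearMap)
    fun _ hc => (CyclicModule.mk_eq_zero _).2 (zeroEmb_mem_twistedIdeal E hc)

theorem twistedEmb_mk (c : u.Cliff) :
    twistedEmb E (CyclicModule.mk _ c) = CyclicModule.mk _ (u.zeroEmb c) := rfl

theorem twistedEmb_smul (c : u.Cliff) (x : CM E) :
    twistedEmb E (c • x) = u.zeroEmb c • twistedEmb E x := by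
  obtain ⟨d, rfl⟩ := CyclicModule.mk_surjective _ x
  rw [← map_smul, twistedEmb_mk, twistedEmb_mk, ← map_smul, smul_eq_mul, smul_eq_mul, map_mul]

/-- Positive modes anticommute with zero modes, so they can be moved past any element of `Cliff(𝔲)`
to the vacuum, which they kill. -/
theorem positive_smul_twistedEmb (x : CM E) (v : V) (m : ℤ) (hm : 0 < 2 * m + Sector.twisted.shift) :
    u.mode .twisted v m • twistedEmb E x = 0 := by
  have hsw : ∀ w : V, u.mode .twisted v m * u.mode .twisted w 0 =
      -(u.mode .twisted w 0 * u.mode .twisted v m) := by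
    intro w
    rw [mode, mode, ι_mul_ι_swap, hatForm_single, Finsupp.single_apply,
      if_neg (by simp only [Sector.shift] at hm ⊢; omega), map_zero, mul_zero, map_zero, add_zero]
  obtain ⟨c, rfl⟩ := CyclicModule.mk_surjective _ x
  rw [twistedEmb_mk]
  induction c using CliffordAlgebra.left_induction with
  | algebraMap r =>
    rw [AlgHom.commutes, CyclicModule.mk_algebraMap, smul_comm,
      u.mk_one_positive (positiveIdeal_le_twistedIdeal E) v m hm, smul_zero]
  | add a b ha hb => rw [map_add, map_add, smul_add, ha, hb, add_zero]
  | ι_mul a w ha =>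
    rw [map_mul, zeroEmb_ι, ← smul_eq_mul, map_smul, ← mul_smul, hsw, neg_smul, mul_smul, ha,
      smul_zero, neg_zero]

/-- The ground states of `A(𝔲)_{θ,E}`. -/
def twistedGround : u.GroundStates (twistedIdeal E) (twistedZero E) where
  emb := twistedEmb E
  vac := CyclicModule.mk _ 1
  emb_vac := by rw [twistedEmb_mk, map_one]
  smul_emb y x := by
    rw [u.ι_smul_of_positive (positive_smul_twistedEmb E x), ← zeroEmb_ι, ← twistedEmb_smul]
    rfl
  rho_eq_zero a ha := by
    rw [twistedIdeal, positiveIdeal, ← Submodule.span_union] at ha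
    induction ha using Submodule.span_induction with
    | mem a h =>
      rcases h with ⟨v, m, hm, rfl⟩ | ⟨g, hg, rfl⟩
      · exact u.rho_positiveIdeal _ _ (Submodule.subset_span ⟨v, m, hm, rfl⟩)
      · have hg0 : CyclicModule.mk (Submodule.span u.Cliff {a | ∃ g ∈ E.group, a = (g : u.Cliff) - 1})
            ((g : u.Cliff) - 1) = 0 :=
          (CyclicModule.mk_eq_zero _).2 (Submodule.subset_span ⟨g, hg, rfl⟩)
        rw [map_sub, LinearMap.sub_apply, rho_zeroEmb, map_one (twistedZero E).rho, Module.End.one_apply,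
          ← TensorProduct.sub_tmul, ← map_smul, ← map_sub (CyclicModule.mk _), smul_eq_mul, mul_one,
          hg0, TensorProduct.zero_tmul]
    | zero => rw [map_zero, LinearMap.zero_apply]
    | add a b _ _ ha hb => rw [map_add, LinearMap.add_apply, ha, hb, add_zero]
    | smul c a _ ha => rw [smul_eq_mul, map_mul, Module.End.mul_apply, ha, map_zero]
  exists_rho_eq x := by
    obtain ⟨c, rfl⟩ := CyclicModule.mk_surjective _ x
    refine ⟨u.zeroEmb c, twistedEmb_mk E c, ?_⟩
    rw [rho_zeroEmb, ← map_smul, smul_eq_mul, mul_one]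

/-- Zero modes have degree zero, hence commute with `L(0)`; all ground states share the weight of
the vacuum. -/
theorem virasoro_twistedEmb (x : CM E) :
    u.virasoro (positiveIdeal_le_twistedIdeal E) 0 (twistedEmb E x) =
      (groundWeight N .twisted : ℂ) • twistedEmb E x := by
  obtain ⟨c, rfl⟩ := CyclicModule.mk_surjective _ x
  rw [twistedEmb_mk]
  induction c using CliffordAlgebra.left_induction with
  | algebraMap r =>
    rw [AlgHom.commutes, CyclicModule.mk_algebraMap, map_smul, virasoro_mk_one, smul_comm]
  | add a b ha hb => simp only [map_add, ha, hb, smul_add]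
  | ι_mul a w ha =>
    rw [map_mul, zeroEmb_ι, ← smul_eq_mul, map_smul, virasoro_mode_smul, ha]
    simp only [Sector.shift, Int.cast_zero, zero_div, add_zero, zero_smul, sub_zero]
    rw [smul_comm]

/-- `Cliff(𝔲)` is linearly isomorphic to the finite-dimensional exterior algebra of `𝔲`. Finiteness
of the ground states is needed for finite-dimensional weight spaces. -/
instance (E : u.HomogeneousLift) : Module.Finite ℂ (CM E) := by
  have : Invertible (2 : ℂ) := invertibleOfNonzero two_ne_zero
  have h1 : Module.Finite ℂ (ExteriorAlgebra ℂ V) := Module.Finite.of_basis u.basis.ExteriorAlgebra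
  have h2 : Module.Finite ℂ u.Cliff := Module.Finite.equiv (equivExterior u.quad).symm
  exact Module.Finite.of_surjective ((CyclicModule.mk _).restrictScalars ℂ)
    (CyclicModule.mk_surjective (Submodule.span u.Cliff {a | ∃ g ∈ E.group, a = (g : u.Cliff) - 1}))

/-! ### The action of the spin group on Fock spaces -/

theorem hatAut_creationAlg (σ : Sector) (x : u.Spin) (w : ExteriorAlgebra ℂ (ℕ →₀ V)) :
    u.hatAut σ x (u.creationAlg σ w) =
      u.creationAlg σ (ExteriorAlgebra.map (Finsupp.mapRange.linearMap (u.toSO x)) w) := by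
  have h : (u.hatAut σ x).comp (u.creationAlg σ) = (u.creationAlg σ).comp
      (ExteriorAlgebra.map (Finsupp.mapRange.linearMap (u.toSO x))) := by
    apply ExteriorAlgebra.hom_ext
    refine Finsupp.lhom_ext fun j v => ?_
    simp only [LinearMap.comp_apply, AlgHom.toLinearMap_apply, AlgHom.comp_apply, creationAlg_ι,
      ExteriorAlgebra.map_apply_ι, creation_single, hatAut_ι, Finsupp.mapRange.linearMap_apply,
      Finsupp.mapRange_single]
  exact congrArg (fun f => f w) h

theorem actA_smul (x : u.Spin) (a : u.HatCliff .untwisted) (b : u.A) :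
    u.actA x (a • b) = u.hatAut .untwisted x a • u.actA x b := by
  obtain ⟨c, rfl⟩ := CyclicModule.mk_surjective _ b
  rw [← map_smul, actA_mk, actA_mk, ← map_smul, smul_eq_mul, smul_eq_mul, map_mul]

theorem actAtw_smul (x : u.Spin) (a : u.HatCliff .twisted) (b : Atw E) :
    actAtw E x (a • b) = u.hatAut .twisted x a • actAtw E x b := by
  obtain ⟨c, rfl⟩ := CyclicModule.mk_surjective _ b
  rw [← map_smul, actAtw_mk, actAtw_mk, ← map_smul, smul_eq_mul, smul_eq_mul,
    map_mul (u.hatAut .twisted x), mul_assoc]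

/-- The conjugation in the twisted action and the final factor `x` combine to `(x c x⁻¹) x = x c`.
So `x` acts on ground states by left multiplication, with trace `chi E x`. -/
theorem actAtw_twistedEmb (x : u.Spin) (y : CM E) :
    actAtw E x (twistedEmb E y) = twistedEmb E ((x : u.Cliff) • y) := by
  obtain ⟨c, rfl⟩ := CyclicModule.mk_surjective _ y
  rw [← map_smul, twistedEmb_mk, twistedEmb_mk, actAtw_mk, hatAut_zeroEmb, ← map_mul, mul_assoc,
    coe_inv_mul, mul_one, smul_eq_mul]

end OrthoSpace

end

end CliffordVOA

/-! ### Summation over the eigenbasis as an infinite product -/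

namespace CliffordVOA
noncomputable section
open scoped TensorProduct

theorem summable_exp_nat_add (τ : UpperHalfPlane) (s : ℂ) :
    Summable fun j : ℕ => ‖Complex.exp (2 * Real.pi * Complex.I * (τ : ℂ) * (j + s))‖ := by
  have h : ∀ j : ℕ, ‖Complex.exp (2 * Real.pi * Complex.I * (τ : ℂ) * (j + s))‖ =
      ‖Complex.exp (2 * Real.pi * Complex.I * (τ : ℂ))‖ ^ j *
        ‖Complex.exp (2 * Real.pi * Complex.I * (τ : ℂ) * s)‖ := by
    intro j
    rw [← norm_pow, ← norm_mul, ← Complex.exp_nat_mul, ← Complex.exp_add]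
    congr 2
    ring
  simp only [h]
  exact (summable_geometric_of_lt_one (norm_nonneg _)
    (UpperHalfPlane.norm_exp_two_pi_I_lt_one τ)).mul_right _

theorem summable_norm_mul_fin {d : ℕ} (c : Fin d → ℂ) {f : ℕ → ℂ} (hf : Summable fun j => ‖f j‖) :
    Summable fun i : ℕ × Fin d => ‖c i.2 * f i.1‖ := by
  have h := Summable.mul_of_nonneg (f := fun j => ‖f j‖) (g := fun l : Fin d => ‖c l‖) hf
    (Summable.of_finite) (fun _ => norm_nonneg _) (fun _ => norm_nonneg _)
  refine h.congr fun i => ?_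
  rw [norm_mul, mul_comm]

/-- This is the absolutely convergent expansion of `∏ (1 + a_i)` over finite subsets of the index
set, with the factors then grouped by the level `j`. -/
theorem hasSum_finset_prod_lex {d : ℕ} (c : Fin d → ℂ) {f : ℕ → ℂ} (hf : Summable fun j => ‖f j‖) :
    HasSum (fun S : Finset (ℕ ×ₗ Fin d) => ∏ i ∈ S, c (ofLex i).2 * f (ofLex i).1)
      (∏' j, ∏ l, (1 + f j * c l)) ∧
    Summable (fun S : Finset (ℕ ×ₗ Fin d) => ‖∏ i ∈ S, c (ofLex i).2 * f (ofLex i).1‖) := by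
  have hs : Summable fun i : ℕ ×ₗ Fin d => ‖c (ofLex i).2 * f (ofLex i).1‖ :=
    (ofLex (α := ℕ × Fin d)).summable_iff.2 (summable_norm_mul_fin c hf)
  have hp := summable_finsetProd_of_summable_norm hs
  refine ⟨?_, hp.norm⟩
  have h1 := hasProd_one_add_of_hasSum_prod hp.hasSum
  have h2 := (toLex (α := ℕ × Fin d)).hasProd_iff.2 h1
  have h3 : HasProd (fun j => ∏ l, (1 + f j * c l)) _ := h2.prod_fiberwise fun j => by
    have e : (fun l => ((fun i : ℕ ×ₗ Fin d => 1 + c (ofLex i).2 * f (ofLex i).1) ∘ toLex) (j, l)) =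
        fun l => 1 + f j * c l := by
      funext l
      simp [mul_comm]
    rw [e]
    exact hasProd_fintype _
  rw [h3.tprod_eq]
  exact hp.hasSum

/-- Coefficients and powers of `q` are multiplicative over the pair of a ground state and a finite
set of creation operators, so the sum is a product of the two sums. -/
theorem hasSum_eigenbasis (τ : UpperHalfPlane) (s : ℂ) {k d : ℕ} (D : Fin k → ℂ) (c : Fin d → ℂ)
    (w : ℂ) :
    HasSum (fun i : Fin k × Finset (ℕ ×ₗ Fin d) => (D i.1 * ∏ j ∈ i.2, c (ofLex j).2) *
        Complex.exp (2 * Real.pi * Complex.I * (τ : ℂ) * (w + ∑ j ∈ i.2, ((ofLex j).1 + s))))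
      ((∑ i, D i) * Complex.exp (2 * Real.pi * Complex.I * (τ : ℂ) * w) *
        ∏' j : ℕ, ∏ l, (1 + Complex.exp (2 * Real.pi * Complex.I * (τ : ℂ) * (j + s)) * c l)) := by
  obtain ⟨h1, h2⟩ := hasSum_finset_prod_lex c (summable_exp_nat_add τ s)
  have h3 := hasSum_fintype D
  have hD : Summable fun i => ‖D i‖ := Summable.of_finite
  have hfg := summable_mul_of_summable_norm hD h2
  have h4 := (h3.mul h1 hfg).mul_left (Complex.exp (2 * Real.pi * Complex.I * (τ : ℂ) * w))
  have e : (∑ i, D i) * Complex.exp (2 * Real.pi * Complex.I * (τ : ℂ) * w) *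
        ∏' j : ℕ, ∏ l, (1 + Complex.exp (2 * Real.pi * Complex.I * (τ : ℂ) * (j + s)) * c l) =
      Complex.exp (2 * Real.pi * Complex.I * (τ : ℂ) * w) * ((∑ i, D i) *
        ∏' j : ℕ, ∏ l, (1 + Complex.exp (2 * Real.pi * Complex.I * (τ : ℂ) * (j + s)) * c l)) := by
    ring
  rw [e]
  refine h4.congr_fun' fun i => ?_
  have e2 : ∏ j ∈ i.2, c (ofLex j).2 *
      Complex.exp (2 * Real.pi * Complex.I * (τ : ℂ) * ((ofLex j).1 + s)) =
      (∏ j ∈ i.2, c (ofLex j).2) * Complex.exp (2 * Real.pi * Complex.I * (τ : ℂ) *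
        ∑ j ∈ i.2, ((ofLex j).1 + s)) := by
    rw [Finset.prod_mul_distrib, ← Complex.exp_sum, ← Finset.mul_sum]
  rw [e2, mul_add, Complex.exp_add]
  ring

theorem det_one_add_smul_of_triangular {V : Type*} [AddCommGroup V] [Module ℂ V] {d : ℕ}
    (b : Module.Basis (Fin d) ℂ V) (h : V →ₗ[ℂ] V) (hb : ∀ i j, j < i → b.repr (h (b i)) j = 0)
    (x : ℂ) : LinearMap.det (LinearMap.id + x • h) = ∏ l, (1 + x * b.repr (h (b l)) l) := by
  rw [← LinearMap.det_toMatrix b, Matrix.det_of_isLowerTriangular]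
  · refine Finset.prod_congr rfl fun l _ => ?_
    simp [LinearMap.toMatrix_apply]
  · intro i j hij
    have : i < j := hij
    simp [LinearMap.toMatrix_apply, hb _ _ this, this.ne']

namespace OrthoSpace

variable {V : Type*} [AddCommGroup V] [Module ℂ V] {N : ℕ} {u : OrthoSpace V N}
variable {σ : Sector} {J : Submodule (u.HatCliff σ) (u.HatCliff σ)} (hJ : u.positiveIdeal σ ≤ J)

/-- The `L(0)`-weight of the creation operator with index `j`. -/
def creationWeight (σ : Sector) (j : ℕ) : ℚ := j + 1 - σ.shift / 2

theorem degree_creation_single (σ : Sector) (j : ℕ) (v : V) :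
    degree σ (creation (Finsupp.single j v)) =
      -(creationWeight σ j : ℂ) • creation (Finsupp.single j v) := by
  rw [creation_single, degree_single, creationWeight]
  congr 1
  push_cast
  ring

/-- Each creation operator has degree minus its `creationWeight`, so moving `L(0)` past it adds that
weight. -/
theorem virasoro_creation_list {b : CyclicModule J} {w : ℂ} (hb : u.virasoro hJ 0 b = w • b)
    (l : List (ℕ × V)) :
    u.virasoro hJ 0 (u.creationAlg σ
        (l.map fun i => ExteriorAlgebra.ι ℂ (Finsupp.single i.1 i.2)).prod • b) =
      (w + ((l.map fun i => creationWeight σ i.1).sum : ℚ)) • u.creationAlg σ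
        (l.map fun i => ExteriorAlgebra.ι ℂ (Finsupp.single i.1 i.2)).prod • b := by
  induction l with
  | nil => simp [hb]
  | cons i l ih =>
    rw [List.map_cons, List.prod_cons, map_mul, creationAlg_ι, mul_smul, virasoro_ι_smul, ih,
      degree_creation_single, map_smul (ι (u.hatQuad σ)), smul_assoc, List.map_cons, List.sum_cons,
      smul_comm (ι (u.hatQuad σ) _)]
    generalize ι (u.hatQuad σ) (creation (Finsupp.single i.1 i.2)) • u.creationAlg σ
      (l.map fun i => ExteriorAlgebra.ι ℂ (Finsupp.single i.1 i.2)).prod • b = X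
    push_cast
    module

/-- The basis of the space of creation operators induced by a basis of `𝔲`. -/
def creationBasis {d : ℕ} (b : Module.Basis (Fin d) ℂ V) :
    Module.Basis (ℕ ×ₗ Fin d) ℂ (ℕ →₀ V) :=
  (Finsupp.basis fun _ : ℕ => b).reindex ((Equiv.sigmaEquivProd ℕ (Fin d)).trans toLex)

theorem creationBasis_apply {d : ℕ} (b : Module.Basis (Fin d) ℂ V) (i : ℕ ×ₗ Fin d) :
    creationBasis b i = Finsupp.single (ofLex i).1 (b (ofLex i).2) := by
  simp [creationBasis, Finsupp.coe_basis]

theorem creationBasis_repr {d : ℕ} (b : Module.Basis (Fin d) ℂ V) (x : ℕ →₀ V) (i : ℕ ×ₗ Fin d) :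
    (creationBasis b).repr x i = b.repr (x (ofLex i).1) (ofLex i).2 := by
  rw [creationBasis, Module.Basis.repr_reindex_apply]
  rfl

theorem virasoro_creationBasis {d : ℕ} (b : Module.Basis (Fin d) ℂ V) {y : CyclicModule J} {w : ℂ}
    (hy : u.virasoro hJ 0 y = w • y) (S : Finset (ℕ ×ₗ Fin d)) :
    u.virasoro hJ 0 (u.creationAlg σ ((creationBasis b).ExteriorAlgebra S) • y) =
      (w + (∑ i ∈ S, creationWeight σ (ofLex i).1 : ℚ)) •
        u.creationAlg σ ((creationBasis b).ExteriorAlgebra S) • y := by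
  -- The basis vector of a subset is the product of its creation operators in increasing order,
  -- which is the form `virasoro_creation_list` handles.
  have hS : ∃ l : List (ℕ ×ₗ Fin d), l.toFinset = S ∧ l.Nodup ∧
      (creationBasis b).ExteriorAlgebra S =
        (l.map fun i => ExteriorAlgebra.ι ℂ (creationBasis b i)).prod := by
    let s : Set.powersetCard (ℕ ×ₗ Fin d) S.card := ⟨S, rfl⟩
    refine ⟨List.ofFn (Set.powersetCard.ofFinEmbEquiv.symm s), ?_, ?_, ?_⟩
    · ext i
      rw [List.mem_toFinset, List.mem_ofFn]
      exact Set.powersetCard.mem_range_ofFinEmbEquiv_symm_iff_mem s i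
    · exact List.nodup_ofFn.2 (Set.powersetCard.ofFinEmbEquiv.symm s).injective
    · change (creationBasis b).ExteriorAlgebra (s : Finset (ℕ ×ₗ Fin d)) = _
      rw [ExteriorAlgebra.basis_apply_powersetCard,
        ExteriorAlgebra.ιMulti_family, ExteriorAlgebra.ιMulti_apply, List.map_ofFn]
      rfl
  obtain ⟨l, rfl, hl, h⟩ := hS
  have := virasoro_creation_list hJ hy (l.map fun i => ((ofLex i).1, b (ofLex i).2))
  rw [List.map_map, List.map_map] at this
  rw [h, List.sum_toFinset _ hl]
  simp only [creationBasis_apply]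
  exact this

/-- A Fock space module with finite-dimensional space of ground states `M` has a basis of
eigenvectors of `L(0)`, in which the trace of a lift of `x ∈ Spin(𝔲)` is an infinite product. -/
theorem hasEigenbasisTrace_of_groundStates {M : Type*} [AddCommGroup M] [Module ℂ M]
    [Module.Finite ℂ M] {Z : u.ZeroModeAction σ M} (G : u.GroundStates J Z)
    (hG : ∀ y, u.virasoro hJ 0 (G.emb y) = (groundWeight N σ : ℂ) • G.emb y) (x : u.Spin)
    {g : Module.End ℂ (CyclicModule J)} (hg : ∀ a b, g (a • b) = u.hatAut σ x a • g b)
    {T : Module.End ℂ M} (hT : ∀ y, g (G.emb y) = G.emb (T y)) (c : ℂ) :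
    HasEigenbasisTrace (u.virasoro hJ 0) g c fun τ => LinearMap.trace ℂ M T *
      Complex.exp (2 * Real.pi * Complex.I * (τ : ℂ) * ((groundWeight N σ : ℂ) - c / 24)) *
      ∏' j : ℕ, LinearMap.det (LinearMap.id +
        Complex.exp (2 * Real.pi * Complex.I * (τ : ℂ) * (j + (1 - σ.shift / 2 : ℂ))) •
          u.toSO x) := by
  have hVfin : Module.Finite ℂ V := Module.Finite.of_basis u.basis
  obtain ⟨b, hb⟩ := exists_triangular_basis _ rfl (u.toSO x)
  have hH : ∀ i j : ℕ ×ₗ Fin (Module.finrank ℂ V), (creationBasis b).repr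
      (Finsupp.mapRange.linearMap (u.toSO x) (creationBasis b i)) j =
      if (ofLex i).1 = (ofLex j).1 then
        b.repr (u.toSO x (b (ofLex i).2)) (ofLex j).2 else 0 := by
    intro i j
    rw [creationBasis_repr, creationBasis_apply, Finsupp.mapRange.linearMap_apply,
      Finsupp.mapRange_single, Finsupp.single_apply]
    split_ifs
    · rfl
    · simp
  -- The image of `x` preserves levels, so coefficients between distinct levels vanish; the
  -- lexicographic order compares levels first, and within one level the triangularity of `b`
  -- applies.
  have htri : ∀ i j : ℕ ×ₗ Fin (Module.finrank ℂ V), j < i → (creationBasis b).repr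
      (Finsupp.mapRange.linearMap (u.toSO x) (creationBasis b i)) j = 0 := by
    intro i j hij
    rw [hH]
    split_ifs with h
    · refine hb _ _ ?_
      rw [Prod.Lex.lt_iff] at hij
      rcases hij with hij | hij
      · omega
      · exact hij.2
    · rfl
  let bM := Module.finBasis ℂ M
  let B := (bM.tensorProduct (creationBasis b).ExteriorAlgebra).map G.fockEquiv
  have hB : ∀ i, B i = u.creationAlg σ ((creationBasis b).ExteriorAlgebra i.2) • G.emb (bM i.1) := by
    intro i
    rw [Module.Basis.map_apply, Module.Basis.tensorProduct_apply', G.fockEquiv_tmul]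
  have hdiag : ∀ i, B.repr (g (B i)) i = bM.repr (T (bM i.1)) i.1 *
      ∏ j ∈ i.2, b.repr (u.toSO x (b (ofLex j).2)) (ofLex j).2 := by
    intro i
    rw [hB, hg, hT, hatAut_creationAlg, ← G.fockEquiv_tmul, Module.Basis.map_repr,
      LinearEquiv.trans_apply, LinearEquiv.symm_apply_apply,
      Module.Basis.tensorProduct_repr_tmul_apply, exteriorAlgebra_repr_map_self _ _ htri,
      smul_eq_mul, mul_comm]
    congr 1
    refine Finset.prod_congr rfl fun j _ => ?_
    rw [hH, if_pos rfl]
  refine ⟨?_, Fin (Module.finrank ℂ M) × Finset (ℕ ×ₗ Fin (Module.finrank ℂ V)), B,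
    fun i => groundWeight N σ + ∑ j ∈ i.2, creationWeight σ (ofLex j).1, ?_, ?_, ?_⟩
  · refine commute_virasoro hJ (u.toSO x) (fun y b => ?_) ?_
    · rw [hg, hatAut_ι]
    · rw [← G.emb_vac, hT, hG]
  · intro n
    -- Weights are nonnegative and grow with the level, so a subset of total weight `n` only uses
    -- levels below the bound `K`. Finitely many subsets remain.
    have hw : ∀ j : ℕ, (j : ℚ) < creationWeight σ j + 1 ∧ 0 ≤ creationWeight σ j := by
      intro j
      have : (0 : ℚ) ≤ j := Nat.cast_nonneg j
      unfold creationWeight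
      cases σ <;> simp only [Sector.shift, Int.cast_one, Int.cast_zero] <;>
        constructor <;> linarith
    let K := ⌈n - groundWeight N σ + 1⌉₊
    let F : Set (ℕ ×ₗ Fin (Module.finrank ℂ V)) := ofLex ⁻¹' (Set.Iio K ×ˢ Set.univ)
    have hF : F.Finite :=
      ((Set.finite_Iio K).prod Set.finite_univ).preimage ofLex.injective.injOn
    refine (Set.finite_univ.prod hF.toFinset.powerset.finite_toSet).subset
      fun i hi => ⟨trivial, ?_⟩
    rw [Finset.mem_coe, Finset.mem_powerset]
    intro j hj
    rw [Set.Finite.mem_toFinset]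
    refine ⟨?_, trivial⟩
    have h1 := Finset.single_le_sum (f := fun j => creationWeight σ (ofLex j).1)
      (fun j _ => (hw (ofLex j).1).2) hj
    have h2 : groundWeight N σ + ∑ j ∈ i.2, creationWeight σ (ofLex j).1 = n := hi
    have h3 := (hw (ofLex j).1).1
    rw [Set.mem_Iio, Nat.lt_ceil]
    linarith
  · intro i
    rw [hB, virasoro_creationBasis hJ b (hG _)]
    push_cast
    rfl
  · intro τ
    have hD : LinearMap.trace ℂ M T = ∑ k, bM.repr (T (bM k)) k := by
      rw [LinearMap.trace_eq_matrix_trace ℂ bM, Matrix.trace]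
      simp only [Matrix.diag_apply, LinearMap.toMatrix_apply]
    simp only [det_one_add_smul_of_triangular b _ hb, hD]
    refine (hasSum_eigenbasis τ (1 - σ.shift / 2) (fun k => bM.repr (T (bM k)) k)
      (fun l => b.repr (u.toSO x (b l)) l) ((groundWeight N σ : ℂ) - c / 24)).congr_fun' fun i => ?_
    rw [hdiag]
    congr 2
    push_cast [creationWeight]
    have : ∀ j : ℕ ×ₗ Fin (Module.finrank ℂ V), ((ofLex j).1 : ℂ) + 1 - σ.shift / 2 =
        (ofLex j).1 + (1 - σ.shift / 2) := fun j => by ring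
    simp only [this]
    ring

end OrthoSpace

end

end CliffordVOA

/-! ### Frame shapes and eta products -/

namespace CliffordVOA
noncomputable section
open Filter Topology

theorem det_sub_smul_eq {V : Type*} [AddCommGroup V] [Module ℂ V] {d : ℕ}
    (b : Module.Basis (Fin d) ℂ V) (h : V →ₗ[ℂ] V) (hb : ∀ i j, j < i → b.repr (h (b i)) j = 0)
    (x : ℂ) : LinearMap.det (LinearMap.id - x • h) = ∏ l, (1 - x * b.repr (h (b l)) l) := by
  have := det_one_add_smul_of_triangular b h hb (-x)
  simpa only [neg_smul, neg_mul, ← sub_eq_add_neg] using this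

theorem det_eq_prod_of_triangular {V : Type*} [AddCommGroup V] [Module ℂ V] {d : ℕ}
    (b : Module.Basis (Fin d) ℂ V) (h : V →ₗ[ℂ] V)
    (hb : ∀ i j, j < i → b.repr (h (b i)) j = 0) :
    LinearMap.det h = ∏ l, b.repr (h (b l)) l := by
  rw [← LinearMap.det_toMatrix b, Matrix.det_of_isLowerTriangular]
  · simp only [LinearMap.toMatrix_apply]
  · intro i j hij
    rw [LinearMap.toMatrix_apply]
    exact hb _ _ hij

variable {V : Type*} [AddCommGroup V] [Module ℂ V] {h : V →ₗ[ℂ] V} {n : ℕ} {m : ℕ → ℤ}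

theorem pow_ne_one_of_norm_lt_one {x : ℂ} (hx : ‖x‖ < 1) {k : ℕ} (hk : k ≠ 0) : x ^ k ≠ 1 := by
  intro h
  have := pow_lt_one₀ (norm_nonneg x) hx hk
  rw [← norm_pow, h, norm_one] at this
  exact lt_irrefl _ this

/-- The degree of a Frame shape is the dimension of the space. -/
theorem HasFrameShape.sum_eq [FiniteDimensional ℂ V] (hm : HasFrameShape h n m)
    (hdet : LinearMap.det h ≠ 0) :
    ∑ k ∈ n.divisors, (k : ℤ) * m k = Module.finrank ℂ V := by
  obtain ⟨d, hd⟩ : ∃ d, Module.finrank ℂ V = d := ⟨_, rfl⟩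
  obtain ⟨b, hb⟩ := exists_triangular_basis d hd h
  rw [hd]
  set s := ∑ k ∈ n.divisors, (k : ℤ) * m k
  -- These are the two sides of the Frame shape identity at `x = 1/y`, cleared of their powers
  -- `y^(-d)` and `y^(-s)`. Both are nonzero at `0`, for `F` because `det h ≠ 0`, so `y^(d-s) = F y
  -- / G y` has a finite nonzero limit at `0`, which forces `d = s`.
  let F : ℂ → ℂ := fun y => ∏ l, (y - b.repr (h (b l)) l)
  let G : ℂ → ℂ := fun y => ∏ k ∈ n.divisors, (y ^ k - 1) ^ m k
  have hk0 : ∀ k ∈ n.divisors, k ≠ 0 := fun k hk => (Nat.pos_of_mem_divisors hk).ne'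
  have hF0 : F 0 ≠ 0 := by
    rw [det_eq_prod_of_triangular b h hb, Finset.prod_ne_zero_iff] at hdet
    refine Finset.prod_ne_zero_iff.2 fun l hl => ?_
    rw [zero_sub]
    exact neg_ne_zero.2 (hdet l hl)
  have hG0 : ∀ y : ℂ, ‖y‖ < 1 → G y ≠ 0 := fun y hy => Finset.prod_ne_zero_iff.2 fun k hk =>
    zpow_ne_zero _ (sub_ne_zero.2 (pow_ne_one_of_norm_lt_one hy (hk0 k hk)))
  have hFc : Tendsto F (𝓝 0) (𝓝 (F 0)) := Continuous.tendsto (by fun_prop) 0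
  have hGc : Tendsto G (𝓝 0) (𝓝 (G 0)) := by
    refine tendsto_finsetProd _ fun k hk => Tendsto.zpow₀ ?_ _ (Or.inl ?_)
    · exact Continuous.tendsto (by fun_prop) 0
    · rw [zero_pow (hk0 k hk)]
      norm_num
  have hkey : ∀ y : ℂ, y ≠ 0 → ‖y‖ < 1 → y ^ ((d : ℤ) - s) = F y / G y := by
    intro y hy0 hy
    have h1 := hm.2 y⁻¹ (by
      rw [inv_pow]
      exact inv_ne_one.2 (pow_ne_one_of_norm_lt_one hy hm.1.ne'))
    rw [det_sub_smul_eq b h hb] at h1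
    have h2 : F y = y ^ d * ∏ l, (1 - y⁻¹ * b.repr (h (b l)) l) := by
      have : y ^ d = ∏ _l : Fin d, y := by simp
      rw [this, ← Finset.prod_mul_distrib]
      refine Finset.prod_congr rfl fun l _ => ?_
      rw [mul_sub, mul_one, mul_inv_cancel_left₀ hy0]
    have h3 : ∏ k ∈ n.divisors, (1 - y⁻¹ ^ k) ^ m k = y ^ (-s) * G y := by
      have : y ^ (-s) = ∏ k ∈ n.divisors, y ^ (-((k : ℤ) * m k)) := by
        rw [← Finset.sum_neg_distrib]
        induction n.divisors using Finset.induction_on with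
        | empty => simp
        | insert a t ha ih => rw [Finset.sum_insert ha, Finset.prod_insert ha, zpow_add₀ hy0, ih]
      rw [this, ← Finset.prod_mul_distrib]
      refine Finset.prod_congr rfl fun k _ => ?_
      have h4 : 1 - y⁻¹ ^ k = y ^ (-(k : ℤ)) * (y ^ k - 1) := by
        rw [zpow_neg, zpow_natCast, mul_sub, inv_mul_cancel₀ (pow_ne_zero _ hy0), mul_one, inv_pow]
      rw [h4, mul_zpow, ← zpow_mul, neg_mul]
    rw [h2, h1, h3, eq_div_iff (hG0 y hy), ← zpow_natCast y d, sub_eq_add_neg, zpow_add₀ hy0,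
      mul_assoc]
  have hlim : Tendsto (fun y : ℂ => y ^ ((d : ℤ) - s)) (𝓝[≠] 0) (𝓝 (F 0 / G 0)) := by
    have hG00 := hG0 0 (by simp)
    refine ((hFc.div hGc hG00).mono_left nhdsWithin_le_nhds).congr' ?_
    have h1 : ∀ᶠ y : ℂ in 𝓝[≠] 0, ‖y‖ < 1 :=
      nhdsWithin_le_nhds (by
        filter_upwards [Metric.ball_mem_nhds (0 : ℂ) one_pos] with y hy
        simpa using hy)
    filter_upwards [h1, self_mem_nhdsWithin] with y hy hy0
    exact (hkey y hy0 hy).symm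
  have hL : F 0 / G 0 ≠ 0 := div_ne_zero hF0 (hG0 0 (by simp))
  have hpos : ∀ e : ℤ, 0 < e → Tendsto (fun y : ℂ => y ^ e) (𝓝[≠] 0) (𝓝 0) := by
    intro e he
    lift e to ℕ using he.le
    have h1 : Tendsto (fun y : ℂ => y ^ e) (𝓝 0) (𝓝 (0 ^ e)) := Continuous.tendsto (by fun_prop) 0
    rw [zero_pow (by omega)] at h1
    simpa using h1.mono_left nhdsWithin_le_nhds
  rcases lt_trichotomy s d with h1 | h1 | h1
  · exact absurd (tendsto_nhds_unique hlim (hpos _ (by omega))) hL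
  · exact h1
  · have h2 := hlim.inv₀ hL
    simp only [← zpow_neg] at h2
    exact absurd (tendsto_nhds_unique h2 (hpos _ (by omega))) (inv_ne_zero hL)

/-- Infinite products of values of `det(Id - h x)` in terms of a Frame shape. -/
theorem HasFrameShape.hasProd (hm : HasFrameShape h n m) {y : ℕ → ℂ}
    (hy : Summable fun j => ‖y j‖) (hy1 : ∀ j, ‖y j‖ < 1) :
    HasProd (fun j => LinearMap.det (LinearMap.id - y j • h))
      (∏ k ∈ n.divisors, (∏' j, (1 - y j ^ k)) ^ m k) ∧
    ∏ k ∈ n.divisors, (∏' j, (1 - y j ^ k)) ^ m k ≠ 0 := by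
  have hk0 : ∀ k ∈ n.divisors, k ≠ 0 := fun k hk => (Nat.pos_of_mem_divisors hk).ne'
  have hs : ∀ k ∈ n.divisors, Summable fun j => ‖-y j ^ k‖ := by
    intro k hk
    refine Summable.of_nonneg_of_le (fun _ => norm_nonneg _) (fun j => ?_) hy
    rw [norm_neg, norm_pow]
    exact pow_le_of_le_one (norm_nonneg _) (hy1 j).le (hk0 k hk)
  -- Nonvanishing is required because the exponents `m k` may be negative: integer powers are
  -- continuous only away from `0` in that case.
  have hP0 : ∀ k ∈ n.divisors, ∏' j, (1 - y j ^ k) ≠ 0 := by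
    intro k hk
    simp only [sub_eq_add_neg]
    refine tprod_one_add_ne_zero_of_summable (fun j => ?_) (hs k hk)
    rw [← sub_eq_add_neg]
    exact sub_ne_zero.2 (pow_ne_one_of_norm_lt_one (hy1 j) (hk0 k hk)).symm
  have hP : ∀ k ∈ n.divisors, HasProd (fun j => (1 - y j ^ k) ^ m k)
      ((∏' j, (1 - y j ^ k)) ^ m k) := by
    intro k hk
    have h1 : HasProd (fun j => 1 - y j ^ k) (∏' j, (1 - y j ^ k)) := by
      have := multipliable_one_add_of_summable (hs k hk)
      simp only [← sub_eq_add_neg] at this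
      exact this.hasProd
    have h2 : Tendsto _ _ _ := h1
    have h3 := h2.zpow₀ (m k) (Or.inl (hP0 k hk))
    simp only [← Finset.prod_zpow] at h3
    exact h3
  refine ⟨?_, Finset.prod_ne_zero_iff.2 fun k hk => zpow_ne_zero _ (hP0 k hk)⟩
  have e : (fun j => LinearMap.det (LinearMap.id - y j • h)) =
      fun j => ∏ k ∈ n.divisors, (1 - y j ^ k) ^ m k := by
    funext j
    exact hm.2 _ (pow_ne_one_of_norm_lt_one (hy1 j) hm.1.ne')
  rw [e]
  exact hasProd_prod hP

theorem norm_exp_lt_one {τ : ℂ} (hτ : 0 < τ.im) :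
    ‖Complex.exp (2 * Real.pi * Complex.I * τ)‖ < 1 :=
  UpperHalfPlane.norm_exp_two_pi_I_lt_one ⟨τ, hτ⟩

theorem summable_norm_pow_succ {x : ℂ} (hx : ‖x‖ < 1) : Summable fun j : ℕ => ‖x ^ (j + 1)‖ := by
  simp only [norm_pow]
  exact (summable_nat_add_iff 1).2 (summable_geometric_of_lt_one (norm_nonneg _) hx)

/-- The product expansion of an eta product. -/
theorem HasFrameShape.etaProduct_eq [FiniteDimensional ℂ V] (hm : HasFrameShape h n m)
    (hdet : LinearMap.det h ≠ 0) {τ : ℂ} (hτ : 0 < τ.im) :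
    etaProduct n m τ =
      Complex.exp (2 * Real.pi * Complex.I * τ * (Module.finrank ℂ V / 24)) *
        ∏' j : ℕ, LinearMap.det
          (LinearMap.id - Complex.exp (2 * Real.pi * Complex.I * τ) ^ (j + 1) • h) ∧
    etaProduct n m τ ≠ 0 := by
  set x := Complex.exp (2 * Real.pi * Complex.I * τ)
  have hx : ‖x‖ < 1 := norm_exp_lt_one hτ
  obtain ⟨h1, h2⟩ := hm.hasProd (summable_norm_pow_succ hx)
    (fun j => by rw [norm_pow]; exact pow_lt_one₀ (norm_nonneg _) hx (by omega))
  have h3 : etaProduct n m τ =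
      Complex.exp (2 * Real.pi * Complex.I * τ * (Module.finrank ℂ V / 24)) *
        ∏ k ∈ n.divisors, (∏' j : ℕ, (1 - (x ^ (j + 1)) ^ k)) ^ m k := by
    -- The prefactors `exp(2πi k τ / 24)` of the functions `η(kτ)` combine through `∑ k m_k = dim
    -- V`.
    have h4 : Complex.exp (2 * Real.pi * Complex.I * τ * (Module.finrank ℂ V / 24)) =
        ∏ k ∈ n.divisors, Complex.exp (2 * Real.pi * Complex.I * (k * τ) / 24) ^ m k := by
      have h5 := congrArg (fun z : ℤ => (z : ℂ)) (hm.sum_eq hdet)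
      push_cast at h5
      rw [← h5]
      simp only [← Complex.exp_int_mul]
      rw [← Complex.exp_sum]
      congr 1
      rw [Finset.sum_div, Finset.mul_sum]
      refine Finset.sum_congr rfl fun k _ => ?_
      ring
    rw [h4, etaProduct, ← Finset.prod_mul_distrib]
    refine Finset.prod_congr rfl fun k _ => ?_
    rw [← mul_zpow, ModularForm.eta, Function.Periodic.qParam]
    congr 2
    refine tprod_congr fun j => ?_
    have hxk : Complex.exp (2 * Real.pi * Complex.I * (k * τ)) = x ^ k := by
      rw [mul_left_comm]
      exact Complex.exp_nat_mul _ k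
    rw [ModularForm.eta_q_eq_pow, hxk, ← pow_mul, ← pow_mul, mul_comm]
  rw [h1.tprod_eq]
  refine ⟨h3, ?_⟩
  rw [h3]
  exact mul_ne_zero (Complex.exp_ne_zero _) h2

/-- In terms of `x = q^(1/2)`, the product at `τ/2` runs over all positive powers of `x` and the one
at `τ` over the even powers; the quotient keeps the odd ones. The exponent is `d/48 - d/24 = -d/48`
with `d = dim V`. -/
theorem HasFrameShape.etaProduct_div_eq [FiniteDimensional ℂ V] (hm : HasFrameShape h n m)
    (hdet : LinearMap.det h ≠ 0) {τ : ℂ} (hτ : 0 < τ.im) :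
    etaProduct n m (τ / 2) / etaProduct n m τ =
      Complex.exp (2 * Real.pi * Complex.I * τ * (-(Module.finrank ℂ V / 48))) *
        ∏' j : ℕ, LinearMap.det
          (LinearMap.id - Complex.exp (2 * Real.pi * Complex.I * (τ / 2)) ^ (2 * j + 1) • h) := by
  have hτ2 : 0 < (τ / 2).im := by
    rw [show τ / 2 = ((1 / 2 : ℝ) : ℂ) * τ by push_cast; ring, Complex.im_ofReal_mul]
    positivity
  obtain ⟨h1, -⟩ := hm.etaProduct_eq hdet hτ2
  obtain ⟨h2, h20⟩ := hm.etaProduct_eq hdet hτ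
  set x := Complex.exp (2 * Real.pi * Complex.I * (τ / 2)) with hxdef
  have hx : ‖x‖ < 1 := norm_exp_lt_one hτ2
  have hxx : Complex.exp (2 * Real.pi * Complex.I * τ) = x ^ 2 := by
    rw [hxdef, ← Complex.exp_nat_mul]
    congr 1
    push_cast
    ring
  have hs := summable_norm_pow_succ hx
  have hlt : ∀ j : ℕ, ‖x ^ (j + 1)‖ < 1 := fun j => by
    rw [norm_pow]; exact pow_lt_one₀ (norm_nonneg _) hx (by omega)
  have ho := (hm.hasProd (y := fun j => x ^ (2 * j + 1))
    (hs.comp_injective (i := fun j => 2 * j) fun a b h => by simpa using h)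
    (fun j => hlt (2 * j))).1
  have he := (hm.hasProd (y := fun j => x ^ (2 * j + 1 + 1))
    (hs.comp_injective (i := fun j => 2 * j + 1) fun a b h => by simpa using h)
    (fun j => hlt (2 * j + 1))).1
  -- The factor of index `j` involves `x^(j+1)`, so even indices give the odd powers.
  have hall := HasProd.even_mul_odd
    (f := fun j : ℕ => LinearMap.det (LinearMap.id - x ^ (j + 1) • h)) ho he
  have hq : ∀ j : ℕ, (x ^ 2) ^ (j + 1) = x ^ (2 * j + 1 + 1) := fun j => by
    rw [← pow_mul]; congr 1
  rw [div_eq_iff h20, h1, h2, hall.tprod_eq]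
  simp only [hxx, hq]
  rw [ho.tprod_eq, he.tprod_eq]
  have hexp : Complex.exp (2 * Real.pi * Complex.I * (τ / 2) * (Module.finrank ℂ V / 24)) =
      Complex.exp (2 * Real.pi * Complex.I * τ * (-(Module.finrank ℂ V / 48))) *
        Complex.exp (2 * Real.pi * Complex.I * τ * (Module.finrank ℂ V / 24)) := by
    rw [← Complex.exp_add]
    congr 1
    ring
  rw [hexp]
  ring

end

end CliffordVOA

/-! ### Traces on the two sectors and projection to the even part -/

namespace CliffordVOA
noncomputable section

namespace OrthoSpace

variable {V : Type*} [AddCommGroup V] [Module ℂ V] {N : ℕ} {u : OrthoSpace V N}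

theorem finrank_eq (u : OrthoSpace V N) : Module.finrank ℂ V = 2 * N := by
  rw [Module.finrank_eq_card_basis u.basis, Fintype.card_fin]

theorem det_toSO_ne_zero (x : u.Spin) : LinearMap.det (u.toSO x) ≠ 0 := by
  intro h
  have h1 := congrArg LinearMap.det (u.toSO_mul x x⁻¹)
  rw [mul_inv_cancel, toSO_one, LinearMap.det_id, LinearMap.det_comp, h, zero_mul] at h1
  exact one_ne_zero h1

/-- Multiplication by `𝔷` exchanges the two Frame shapes, and keeps determinant arguments for `-ḡ`
within the spin group. -/
theorem neg_toSO (x : u.Spin) : -u.toSO x = u.toSO (u.z * x) := by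
  rw [toSO_mul, toSO_z, LinearMap.neg_comp, LinearMap.id_comp]

theorem id_add_smul_toSO (x : u.Spin) (c : ℂ) :
    LinearMap.id + c • u.toSO x = LinearMap.id - c • -u.toSO x := by
  rw [smul_neg, sub_neg_eq_add]

/-- The graded trace of an element of the spin group on `A(𝔲)`. -/
theorem hasEigenbasisTrace_actA (x : u.Spin) {n : ℕ} {m : ℕ → ℤ}
    (hm : HasFrameShape (-u.toSO x) n m) :
    HasEigenbasisTrace (u.virasoro (le_refl (u.positiveIdeal .untwisted)) 0) (u.actA x) N
      fun τ => etaProduct n m ((τ : ℂ) / 2) / etaProduct n m τ := by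
  have : FiniteDimensional ℂ V := u.basis.finiteDimensional_of_finite
  have hemb : ∀ y : ℂ, u.untwistedGround.emb y = y • CyclicModule.mk _ 1 := fun _ => rfl
  have h := hasEigenbasisTrace_of_groundStates le_rfl u.untwistedGround
    (fun y => by rw [hemb, map_smul, virasoro_mk_one, smul_comm]) x (u.actA_smul x)
    (T := LinearMap.id) (fun y => by rw [hemb, map_smul, actA_mk, map_one, LinearMap.id_apply, hemb])
    N
  convert h using 2 with τ
  rw [hm.etaProduct_div_eq (by rw [neg_toSO]; exact det_toSO_ne_zero _) τ.2, LinearMap.trace_id,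
    Module.finrank_self, Nat.cast_one, one_mul, u.finrank_eq]
  congr 1
  -- The exponents agree since `0 - N/24 = -2N/48`.
  · congr 2
    simp only [groundWeight]
    push_cast
    ring
  · refine tprod_congr fun j => ?_
    rw [id_add_smul_toSO, ← Complex.exp_nat_mul]
    congr 4
    simp only [Sector.shift]
    push_cast
    ring

/-- The graded trace of an element of the spin group on `A(𝔲)_{θ,E}`. -/
theorem hasEigenbasisTrace_actAtw (E : u.HomogeneousLift) (x : u.Spin) {n : ℕ} {m : ℕ → ℤ}
    (hm : HasFrameShape (-u.toSO x) n m) :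
    HasEigenbasisTrace (u.virasoro (positiveIdeal_le_twistedIdeal E) 0) (actAtw E x) N
      fun τ => chi E x * etaProduct n m τ := by
  have : FiniteDimensional ℂ V := u.basis.finiteDimensional_of_finite
  have h := hasEigenbasisTrace_of_groundStates (positiveIdeal_le_twistedIdeal E) (twistedGround E)
    (virasoro_twistedEmb E) x (actAtw_smul E x)
    (T := Algebra.lsmul ℂ ℂ (CM E) (x : u.Cliff)) (actAtw_twistedEmb E x) N
  convert h using 2 with τ
  rw [(hm.etaProduct_eq (by rw [neg_toSO]; exact det_toSO_ne_zero _) τ.2).1, u.finrank_eq,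
    ← mul_assoc, chi]
  congr 1
  -- The exponents agree since `N/8 - N/24 = 2N/24`.
  · congr 2
    simp only [groundWeight]
    push_cast
    ring
  · refine tprod_congr fun j => ?_
    rw [id_add_smul_toSO, ← Complex.exp_nat_mul]
    congr 4
    simp only [Sector.shift]
    push_cast
    ring

/-! ### The projection to the even part -/

theorem hatAut_z_eq_involute (σ : Sector) (a : u.HatCliff σ) :
    u.hatAut σ u.z a = involute a := by
  have h : u.hatAut σ u.z = involute := by
    apply CliffordAlgebra.hom_ext
    ext m v
    change u.hatAut σ u.z (u.mode σ v m) = involute (ι (u.hatQuad σ) (Finsupp.single m v))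
    rw [hatAut_mode, toSO_z, involute_ι, mode]
    simp
  rw [h]

theorem half_add_involute_even {M : Type*} [AddCommGroup M] [Module ℂ M] (Q : QuadraticForm ℂ M)
    (a : CliffordAlgebra Q) : (1 / 2 : ℂ) • (a + involute a) ∈ evenOdd Q 0 := by
  have ha : a ∈ evenOdd Q 0 ⊔ evenOdd Q 1 := by
    rw [(evenOdd_isCompl Q).sup_eq_top]
    exact Submodule.mem_top
  obtain ⟨b, hb, c, hc, rfl⟩ := Submodule.mem_sup.1 ha
  rw [map_add, involute_eq_of_mem_even hb, involute_eq_of_mem_odd hc]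
  convert hb using 1
  rw [add_add_add_comm, add_neg_cancel, add_zero, smul_add, ← add_smul]
  norm_num

theorem actA_z_mk (a : u.HatCliff .untwisted) :
    u.actA u.z (CyclicModule.mk _ a) = CyclicModule.mk _ (involute a) := by
  rw [actA_mk, hatAut_z_eq_involute]

/-- The twisted action multiplies on the right by `𝔷(0)`, which is invisible in the quotient because
`e_Σ ∈ E` fixes the vacuum. What is left is the automorphism induced by `-1` on `𝔲`, the parity
involution. -/
theorem actAtw_z_mk (E : u.HomogeneousLift) (a : u.HatCliff .twisted) :
    actAtw E u.z (CyclicModule.mk _ a) = CyclicModule.mk _ (involute a) := by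
  rw [actAtw_mk, hatAut_z_eq_involute, ← sub_eq_zero, ← map_sub, CyclicModule.mk_eq_zero,
    ← mul_sub_one]
  obtain ⟨g, hg, hgz⟩ := E.top_mem
  refine Submodule.smul_mem _ _ (Submodule.mem_sup_right (Submodule.subset_span ⟨g, hg, ?_⟩))
  rw [hgz]
  rfl

section EvenProjection

variable {σ : Sector} {J : Submodule (u.HatCliff σ) (u.HatCliff σ)}
  {θ : Module.End ℂ (CyclicModule J)}
  (hθ : ∀ a, θ (CyclicModule.mk J a) = CyclicModule.mk J (involute a))

/-- The projection `(1 + θ) / 2` to the even part, where `θ` is the parity involution. -/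
def evenProj : CyclicModule J →ₗ[ℂ] u.evenPart J :=
  ((1 / 2 : ℂ) • (1 + θ)).codRestrict _ fun b => by
    obtain ⟨a, rfl⟩ := CyclicModule.mk_surjective _ b
    refine ⟨_, half_add_involute_even _ a, ?_⟩
    change CyclicModule.mk J _ = (1 / 2 : ℂ) • (CyclicModule.mk J a + θ (CyclicModule.mk J a))
    rw [hθ, ← map_add]
    rfl

theorem coe_evenProj (b : CyclicModule J) :
    (evenProj hθ b : CyclicModule J) = (1 / 2 : ℂ) • (b + θ b) := rfl

theorem evenProj_coe (b : u.evenPart J) : evenProj hθ b = b := by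
  refine Subtype.ext ?_
  obtain ⟨_, a, ha, rfl⟩ := b
  rw [coe_evenProj]
  change (1 / 2 : ℂ) • (CyclicModule.mk J a + θ (CyclicModule.mk J a)) = CyclicModule.mk J a
  rw [hθ, involute_eq_of_mem_even ha, smul_add, ← add_smul]
  norm_num

end EvenProjection

theorem actA_mul (x y : u.Spin) (b : u.A) : u.actA (x * y) b = u.actA x (u.actA y b) := by
  obtain ⟨a, rfl⟩ := CyclicModule.mk_surjective _ b
  rw [actA_mk, actA_mk, actA_mk, hatAut_mul]

theorem actAtw_mul (E : u.HomogeneousLift) (x y : u.Spin) (b : Atw E) :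
    actAtw E (x * y) b = actAtw E x (actAtw E y b) := by
  obtain ⟨a, rfl⟩ := CyclicModule.mk_surjective _ b
  rw [actAtw_mk, actAtw_mk, actAtw_mk, hatAut_mul, map_mul (u.hatAut .twisted x),
    hatAut_zeroEmb, mul_assoc, ← map_mul u.zeroEmb, mul_assoc _ _ (x : u.Cliff), coe_inv_mul,
    mul_one, Submonoid.coe_mul]

/-- The McKay-Thompson series on `A^f(𝔲)` from those on `A(𝔲) ⊕ A(𝔲)_{θ,E}`. -/
theorem hasMcKayThompsonSeries_spinAct (E : u.HomogeneousLift) (x : u.Spin) {c : ℂ}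
    {f f' : UpperHalfPlane → ℂ}
    (hzA : Commute (u.virasoro (le_refl (u.positiveIdeal .untwisted)) 0) (u.actA u.z))
    (hzB : Commute (u.virasoro (positiveIdeal_le_twistedIdeal E) 0) (actAtw E u.z))
    (h : HasMcKayThompsonSeries
      (LinearMap.prodMap (u.virasoro (le_refl (u.positiveIdeal .untwisted)) 0)
        (u.virasoro (positiveIdeal_le_twistedIdeal E) 0))
      (LinearMap.prodMap (u.actA x) (actAtw E x)) c f)
    (h' : HasMcKayThompsonSeries
      (LinearMap.prodMap (u.virasoro (le_refl (u.positiveIdeal .untwisted)) 0)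
        (u.virasoro (positiveIdeal_le_twistedIdeal E) 0))
      (LinearMap.prodMap (u.actA (u.z * x)) (actAtw E (u.z * x))) c f') :
    HasMcKayThompsonSeries (L0 E) (spinAct E x) c fun τ => (1 / 2 : ℂ) * (f τ + f' τ) := by
  refine (h.average h').retract
    (LinearMap.prodMap (Submodule.subtype _) (Submodule.subtype _))
    (LinearMap.prodMap (evenProj actA_z_mk) (evenProj (actAtw_z_mk E))) ?_ ?_ ?_ ?_
  · exact LinearMap.ext fun p => Prod.ext (evenProj_coe actA_z_mk p.1)
      (evenProj_coe (actAtw_z_mk E) p.2)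
  · rfl
  · refine LinearMap.ext fun p => Prod.ext (Subtype.ext ?_) (Subtype.ext ?_)
    · change (1 / 2 : ℂ) • (u.virasoro _ 0 p.1 + u.actA u.z (u.virasoro _ 0 p.1)) =
        u.virasoro _ 0 ((1 / 2 : ℂ) • (p.1 + u.actA u.z p.1))
      rw [map_smul, map_add]
      exact congrArg (fun b => (1 / 2 : ℂ) • (u.virasoro _ 0 p.1 + b))
        (LinearMap.congr_fun hzA.eq p.1).symm
    · change (1 / 2 : ℂ) • (u.virasoro (positiveIdeal_le_twistedIdeal E) 0 p.2 +
          actAtw E u.z (u.virasoro (positiveIdeal_le_twistedIdeal E) 0 p.2)) =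
        u.virasoro (positiveIdeal_le_twistedIdeal E) 0 ((1 / 2 : ℂ) • (p.2 + actAtw E u.z p.2))
      rw [map_smul, map_add]
      exact congrArg (fun b => (1 / 2 : ℂ) •
        (u.virasoro (positiveIdeal_le_twistedIdeal E) 0 p.2 + b))
        (LinearMap.congr_fun hzB.eq p.2).symm
  -- Since `𝔷` is central, acting by `x` after the projection `(1 + 𝔷)/2` is the average of the
  -- actions of `x` and `𝔷x`.
  · refine LinearMap.ext fun p => Prod.ext ?_ ?_
    · change u.actA x ((1 / 2 : ℂ) • (p.1 + u.actA u.z p.1)) =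
        (1 / 2 : ℂ) • (u.actA x p.1 + u.actA (u.z * x) p.1)
      rw [map_smul, map_add, z_comm, actA_mul]
    · change actAtw E x ((1 / 2 : ℂ) • (p.2 + actAtw E u.z p.2)) =
        (1 / 2 : ℂ) • (actAtw E x p.2 + actAtw E (u.z * x) p.2)
      rw [map_smul, map_add, z_comm, actAtw_mul]

theorem commute_virasoro_actA (x : u.Spin) :
    Commute (u.virasoro (le_refl (u.positiveIdeal .untwisted)) 0) (u.actA x) := by
  refine commute_virasoro le_rfl (u.toSO x) (fun y b => ?_) ?_
  · rw [actA_smul, hatAut_ι]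
  · rw [actA_mk, map_one, virasoro_mk_one]

theorem commute_virasoro_actAtw (E : u.HomogeneousLift) (x : u.Spin) :
    Commute (u.virasoro (positiveIdeal_le_twistedIdeal E) 0) (actAtw E x) := by
  refine commute_virasoro (positiveIdeal_le_twistedIdeal E) (u.toSO x) (fun y b => ?_) ?_
  · rw [actAtw_smul, hatAut_ι]
  · rw [actAtw_mk, map_one, one_mul, ← twistedEmb_mk, virasoro_twistedEmb]

/-- The McKay-Thompson series of an element of the spin group on `A^f(𝔲)`. -/
theorem hasMcKayThompsonSeries_of_hasFrameShape (E : u.HomogeneousLift) (x : u.Spin)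
    {n n' : ℕ} {m m' : ℕ → ℤ} (hm : HasFrameShape (u.toSO x) n m)
    (hm' : HasFrameShape (-u.toSO x) n' m') :
    HasMcKayThompsonSeries (L0 E) (spinAct E x) (N : ℂ) fun τ => (1 / 2 : ℂ) *
      (etaProduct n m ((τ : ℂ) / 2) / etaProduct n m τ
        + etaProduct n' m' ((τ : ℂ) / 2) / etaProduct n' m' τ
        + chi E (u.z * x) * etaProduct n m τ + chi E x * etaProduct n' m' τ) := by
  -- The trace formulas for an element use the Frame shape of minus its image; for `𝔷x` this is the
  -- Frame shape of the image of `x`.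
  have hz : HasFrameShape (-u.toSO (u.z * x)) n m := by
    rwa [← neg_toSO, neg_neg]
  have h := hasMcKayThompsonSeries_spinAct E x (commute_virasoro_actA u.z)
    (commute_virasoro_actAtw E u.z)
    ((hasEigenbasisTrace_actA x hm').prodMap
      (hasEigenbasisTrace_actAtw E x hm')).hasMcKayThompsonSeries
    ((hasEigenbasisTrace_actA (u.z * x) hz).prodMap
      (hasEigenbasisTrace_actAtw E (u.z * x) hz)).hasMcKayThompsonSeries
  convert h using 2 with τ
  ring

end OrthoSpace

end

end CliffordVOA

theorem mainTheorem9 {V : Type*} [AddCommGroup V] [Module ℂ V] (N : ℕ) (hN : 4 ∣ N)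
    (u : CliffordVOA.OrthoSpace V N) (E : u.HomogeneousLift)
    (g : u.SpinQuot) (gHat : u.Spin) (hg : (gHat : u.SpinQuot) = g)
    (n n' : ℕ) (m m' : ℕ → ℤ)
    (hm : CliffordVOA.HasFrameShape (u.toSO gHat) n m)
    (hm' : CliffordVOA.HasFrameShape (-u.toSO gHat) n' m') :
    CliffordVOA.HasMcKayThompsonSeries
      (CliffordVOA.OrthoSpace.L0 E) (CliffordVOA.OrthoSpace.act E g) (N : ℂ)
      (fun τ => (1 / 2 : ℂ) *
        (CliffordVOA.etaProduct n m ((τ : ℂ) / 2) / CliffordVOA.etaProduct n m τ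
          + CliffordVOA.etaProduct n' m' ((τ : ℂ) / 2) / CliffordVOA.etaProduct n' m' τ
          + CliffordVOA.OrthoSpace.chi E (u.z * gHat) * CliffordVOA.etaProduct n m τ
          + CliffordVOA.OrthoSpace.chi E gHat * CliffordVOA.etaProduct n' m' τ)) := by
  subst hg
  -- The quotient action of the class of a lift is by definition the action of the lift.
  exact CliffordVOA.OrthoSpace.hasMcKayThompsonSeries_of_hasFrameShape E gHat hm hm'
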